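/- Let $A$ and $B$ be $\mathbb{Z}/2\mathbb{Z}$-graded $C^*$-algebras with $A$ separable and $B$ $\sigma$-unital (i.e. with a countable approximate identity), and let $\mathcal{A} \subseteq A$ be a norm-dense graded $*$-subalgebra which is countably generated as a $*$-algebra. Equip $C([0,1],B)$ with the pointwise grading. An *unbounded Kasparov module* from $\mathcal{A}$ to $B$ is a pair $(X,D)$, where $X$ is a countably generated $\mathbb{Z}/2\mathbb{Z}$-graded $C^*$-correspondence from $A$ to $B$ (a graded right Hilbert $C^*$-module over $B$ with an even $*$-homomorphism from $A$ to the bounded adjointable operators on $X$) and $D\colon \operatorname{Dom}(D) \to X$ is a densely defined odd selfadjoint and regular operator such that 1. each $a \in \mathcal{A}$ preserves $\operatorname{Dom}(D)$, and the graded commutator $[D,a]\colon \operatorname{Dom}(D) \to X$ extends to a bounded operator on $X$; 2. $a\,(i+D)^{-1}$ is a compact operator on the Hilbert $C^*$-module $X$ for all $a \in \mathcal{A}$. An unbounded Kasparov module $(Y,E)$ from $\mathcal{A}$ to $C([0,1],B)$ is a *homotopy* from $(X_0,D_0)$ to $(X_1,D_1)$ if, for $j = 0,1$, there is an even unitary isomorphism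 of $C^*$-correspondences from the interior tensor product $Y \widehat\otimes_{\mathrm{ev}_j} B$ to $X_j$ which carries $E \widehat\otimes_{\mathrm{ev}_j} 1$ (the closure of the operator $y \otimes b \mapsto Ey \otimes b$ on the span of the $y \otimes b$ with $y \in \operatorname{Dom}(E)$, $b \in B$) to $D_j$; here $\mathrm{ev}_t\colon C([0,1],B) \to B$ is evaluation at $t$. If such a homotopy exists, $(X_0,D_0)$ and $(X_1,D_1)$ are called *homotopic*. **Statement.** Let $(X,D)$ be an unbounded Kasparov module from $\mathcal{A}$ to $B$ and let $T\colon X \to X$ be an odd bounded selfadjoint operator. Then $(X, D+T)$, with $\operatorname{Dom}(D+T) = \operatorname{Dom}(D)$, is an unbounded Kasparov module from $\mathcal{A}$ to $B$, and $(X,D)$ and $(X,D+T)$ are homotopic. More precisely, a homotopy from $(X,D)$ to $(X,D+T)$ is given by $(C([0,1],X),E)$, where $$\operatorname{Dom}(E) = \{\xi \in C([0,1],X) : \xi(t) \in \operatorname{Dom}(D) \text{ for all } t \in [0,1] \text{ and } t \mapsto D\xi(t) \text{ is continuous}\},$$ $$(E\xi)(t) = (D + tT)\,\xi(t) \quad \text{for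 all } t \in [0,1].$$ -/

import Mathlib

universe u v w z

noncomputable section

namespace UnboundedKK

/-- A `ℤ/2ℤ`-grading of a C⋆-algebra, given by its grading operator: a `⋆`-automorphism of order two
(`1` on the even part and `-1` on the odd part). -/
class GradedCStarAlgebra (A : Type*) [NonUnitalCStarAlgebra A] where
  grading : A →⋆ₙₐ[ℂ] A
  grading_grading : ∀ a, grading (grading a) = a

lemma continuous_grading (A : Type*) [NonUnitalCStarAlgebra A] [GradedCStarAlgebra A] :
    Continuous (GradedCStarAlgebra.grading (A := A)) := by
  open scoped CStarAlgebra in exact map_continuous _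


/-- A `B`-valued semi-inner product (conjugate linear in the first and `ℂ`-linear and right
`B`-linear in the second variable) on a right `B`-module. Positive elements of `B` are those of the
form `star c * c`. (Mathlib's `CStarModule` has the algebra acting on the other side, with
`inner x (a • y) = a * inner x y`, and needs an order on the algebra.) -/
class PreHilbertModule (B : Type*) (X : Type*) [NonUnitalCStarAlgebra B] [AddCommGroup X]
    [Module ℂ X] where
  /-- the right action of `B` -/
  act : X →ₗ[ℂ] B →ₗ[ℂ] X
  inner : X →ₗ⋆[ℂ] X →ₗ[ℂ] B
  act_act : ∀ x b c, act (act x b) c = act x (b * c)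
  inner_act : ∀ x y b, inner x (act y b) = inner x y * b
  star_inner : ∀ x y, star (inner x y) = inner y x
  inner_self_pos : ∀ x, ∃ c, inner x x = star c * c

/-- The right action of `b : B` on `x : X`. -/
notation:70 x:70 " ◃ " b:71 => PreHilbertModule.act x b

/-- The `B`-valued inner product. -/
notation "⟪" x ", " y "⟫[" B "]" => @PreHilbertModule.inner B _ _ _ _ _ x y

/-- The norm of `X` is the one induced by the `B`-valued inner product. A Hilbert C⋆-module over `B`
is a complex Banach space with this structure (right modules; the inner product is definite because
the norm is). -/
class HilbertModule (B : Type*) (X : Type*) [NonUnitalCStarAlgebra B] [SeminormedAddCommGroup X]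
    [NormedSpace ℂ X] extends PreHilbertModule B X where
  norm_sq : ∀ x : X, ‖x‖ ^ 2 = ‖inner x x‖

namespace PreHilbertModule

section algebraic

variable {B X : Type*} [NonUnitalCStarAlgebra B] [AddCommGroup X] [Module ℂ X]
  [PreHilbertModule B X]

lemma inner_act_left (x y : X) (b : B) : ⟪x ◃ b, y⟫[B] = star b * ⟪x, y⟫[B] := by
  rw [← star_inner, inner_act, star_mul, star_inner]

lemma pre_inner_smul_left (z : ℂ) (x y : X) : ⟪z • x, y⟫[B] = star z • ⟪x, y⟫[B] := by
  rw [map_smulₛₗ, LinearMap.smul_apply]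
  rfl

lemma pre_inner_smul_right (z : ℂ) (x y : X) : ⟪x, z • y⟫[B] = z • ⟪x, y⟫[B] := map_smul _ z y

lemma pre_inner_add_left (x y z : X) : ⟪x + y, z⟫[B] = ⟪x, z⟫[B] + ⟪y, z⟫[B] := by
  rw [map_add, LinearMap.add_apply]

lemma pre_inner_add_right (x y z : X) : ⟪x, y + z⟫[B] = ⟪x, y⟫[B] + ⟪x, z⟫[B] := map_add _ y z

/-- The Cauchy–Schwarz inequality. -/
lemma norm_inner_sq_le (x y : X) : ‖⟪x, y⟫[B]‖ ^ 2 ≤ ‖⟪x, x⟫[B]‖ * ‖⟪y, y⟫[B]‖ := by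
  let _ := CStarAlgebra.spectralOrder B
  have := CStarAlgebra.spectralOrderedRing B
  have key : ∀ l : ℝ, ‖⟪x, x⟫[B]‖ < l → ‖⟪x, y⟫[B]‖ ^ 2 ≤ l * ‖⟪y, y⟫[B]‖ := by
    intro l hl
    have hl0 : 0 < l := (norm_nonneg _).trans_lt hl
    set a : B := ⟪x, y⟫[B] with ha
    have h0 : (0 : B) ≤ ⟪x ◃ a - (l : ℂ) • y, x ◃ a - (l : ℂ) • y⟫[B] := by
      obtain ⟨c, hc⟩ := inner_self_pos (B := B) (x ◃ a - (l : ℂ) • y)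
      rw [hc]; exact star_mul_self_nonneg c
    have hexp : ⟪x ◃ a - (l : ℂ) • y, x ◃ a - (l : ℂ) • y⟫[B]
        = star a * ⟪x, x⟫[B] * a - (2 * l) • (star a * a) + (l ^ 2) • ⟪y, y⟫[B] := by
      have hya : ⟪y, x⟫[B] = star a := by rw [ha, star_inner]
      have e : ∀ p q : X, ⟪p - q, p - q⟫[B] = ⟪p, p⟫[B] - ⟪p, q⟫[B] - ⟪q, p⟫[B] + ⟪q, q⟫[B] := by
        intro p q
        rw [map_sub, map_sub, LinearMap.sub_apply, LinearMap.sub_apply]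
        abel
      have s₁ : ∀ p q : X, ⟪(l : ℂ) • p, q⟫[B] = l • ⟪p, q⟫[B] := by
        intro p q
        rw [map_smulₛₗ, LinearMap.smul_apply, Complex.conj_ofReal, Complex.coe_smul]
      have s₂ : ∀ p q : X, ⟪p, (l : ℂ) • q⟫[B] = l • ⟪p, q⟫[B] := by
        intro p q
        rw [map_smul, Complex.coe_smul]
      rw [e, s₁, s₁, s₂, s₂, inner_act, inner_act_left, inner_act, inner_act_left, hya, ← ha]
      module
    have hle : star a * ⟪x, x⟫[B] * a ≤ l • (star a * a) := by
      have hsa : IsSelfAdjoint ⟪x, x⟫[B] := star_inner _ _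
      refine (CStarAlgebra.star_left_conjugate_le_norm_smul hsa).trans ?_
      exact smul_le_smul_of_nonneg_right hl.le (star_mul_self_nonneg a)
    have h1 : l • (star a * a) ≤ (l ^ 2) • ⟪y, y⟫[B] := by
      rw [hexp] at h0
      have h2 : (0 : B) ≤ l • (star a * a) - (2 * l) • (star a * a) + (l ^ 2) • ⟪y, y⟫[B] :=
        h0.trans (by gcongr)
      have h3 : l • (star a * a) - (2 * l) • (star a * a) + (l ^ 2) • ⟪y, y⟫[B]
          = (l ^ 2) • ⟪y, y⟫[B] - l • (star a * a) := by module
      rw [h3] at h2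
      exact sub_nonneg.mp h2
    have h4 : ‖l • (star a * a)‖ ≤ ‖(l ^ 2) • ⟪y, y⟫[B]‖ :=
      CStarAlgebra.norm_le_norm_of_nonneg_of_le
        (smul_nonneg hl0.le (star_mul_self_nonneg a)) h1
    rw [norm_smul, norm_smul, CStarRing.norm_star_mul_self, Real.norm_of_nonneg hl0.le,
      Real.norm_of_nonneg (by positivity)] at h4
    have : l * ‖a‖ ^ 2 ≤ l * (l * ‖⟪y, y⟫[B]‖) := by nlinarith
    exact le_of_mul_le_mul_left this hl0
  refine le_of_forall_pos_le_add fun ε hε => ?_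
  have h := key (‖⟪x, x⟫[B]‖ + ε / (‖⟪y, y⟫[B]‖ + 1)) (by
    have : 0 < ε / (‖⟪y, y⟫[B]‖ + 1) := by positivity
    linarith)
  refine h.trans ?_
  rw [add_mul]
  have : ε / (‖⟪y, y⟫[B]‖ + 1) * ‖⟪y, y⟫[B]‖ ≤ ε := by
    rw [div_mul_eq_mul_div, div_le_iff₀ (by positivity)]
    nlinarith [norm_nonneg ⟪y, y⟫[B]]
  linarith

variable (B) in
/-- The seminorm of a `B`-valued semi-inner product. -/
def toAddGroupSeminorm (X : Type*) [AddCommGroup X] [Module ℂ X] [PreHilbertModule B X] :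
    AddGroupSeminorm X where
  toFun x := √‖⟪x, x⟫[B]‖
  map_zero' := by simp
  neg' x := by simp
  add_le' x y := by
    have hxy : ‖⟪x, y⟫[B]‖ ≤ √‖⟪x, x⟫[B]‖ * √‖⟪y, y⟫[B]‖ := by
      rw [← Real.sqrt_mul (norm_nonneg _)]
      exact Real.le_sqrt_of_sq_le (norm_inner_sq_le x y)
    have hyx : ‖⟪y, x⟫[B]‖ ≤ √‖⟪x, x⟫[B]‖ * √‖⟪y, y⟫[B]‖ := by
      rwa [← star_inner, norm_star]
    refine Real.sqrt_le_iff.mpr ⟨by positivity, ?_⟩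
    have hx := Real.sq_sqrt (norm_nonneg ⟪x, x⟫[B])
    have hy := Real.sq_sqrt (norm_nonneg ⟪y, y⟫[B])
    calc ‖⟪x + y, x + y⟫[B]‖ = ‖⟪x, x⟫[B] + ⟪x, y⟫[B] + ⟪y, x⟫[B] + ⟪y, y⟫[B]‖ := by
          simp only [map_add, LinearMap.add_apply]; congr 1; abel
      _ ≤ ‖⟪x, x⟫[B]‖ + ‖⟪x, y⟫[B]‖ + ‖⟪y, x⟫[B]‖ + ‖⟪y, y⟫[B]‖ :=
          (norm_add_le _ _).trans (add_le_add_left norm_add₃_le _)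
      _ ≤ _ := by nlinarith

end algebraic

section norm

variable {B X : Type*} [NonUnitalCStarAlgebra B] [SeminormedAddCommGroup X] [NormedSpace ℂ X]
  [HilbertModule B X]

lemma norm_inner_le (x y : X) : ‖⟪x, y⟫[B]‖ ≤ ‖x‖ * ‖y‖ := by
  refine (sq_le_sq₀ (by positivity) (by positivity)).mp ?_
  rw [mul_pow, HilbertModule.norm_sq (B := B) x, HilbertModule.norm_sq (B := B) y]
  exact norm_inner_sq_le x y

lemma norm_act_le (x : X) (b : B) : ‖x ◃ b‖ ≤ ‖x‖ * ‖b‖ := by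
  refine (sq_le_sq₀ (by positivity) (by positivity)).mp ?_
  rw [mul_pow, HilbertModule.norm_sq (B := B) (x ◃ b), HilbertModule.norm_sq (B := B) x,
    inner_act, inner_act_left]
  calc ‖star b * ⟪x, x⟫[B] * b‖ ≤ ‖star b‖ * ‖⟪x, x⟫[B]‖ * ‖b‖ :=
        (norm_mul_le _ _).trans (by gcongr; exact norm_mul_le _ _)
    _ = _ := by rw [norm_star]; ring

variable (B X) in
/-- The inner product as a continuous sesquilinear map. -/
def innerL : X →L⋆[ℂ] X →L[ℂ] B :=
  LinearMap.mkContinuous₂ (PreHilbertModule.inner (B := B) (X := X)) 1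
    fun x y => by simpa using norm_inner_le x y

variable (B X) in
/-- The right action as a continuous bilinear map. -/
def actL : X →L[ℂ] B →L[ℂ] X :=
  LinearMap.mkContinuous₂ (PreHilbertModule.act (B := B) (X := X)) 1
    fun x y => by simpa using norm_act_le x y

@[simp] lemma innerL_apply (x y : X) : innerL B X x y = ⟪x, y⟫[B] := rfl

@[simp] lemma actL_apply (x : X) (b : B) : actL B X x b = x ◃ b := rfl

end norm

end PreHilbertModule

open PreHilbertModule

/-- The set of positive elements of a C⋆-algebra is closed. -/
lemma isClosed_positive (B : Type*) [NonUnitalCStarAlgebra B] :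
    IsClosed {b : B | ∃ c, b = star c * c} := by
  let _ := CStarAlgebra.spectralOrder B
  have := CStarAlgebra.spectralOrderedRing B
  have h : {b : B | ∃ c, b = star c * c} = {b : B | 0 ≤ b} := by
    ext b; exact CStarAlgebra.nonneg_iff_eq_star_mul_self.symm
  rw [h]
  exact isClosed_Ici

/-- A continuous function with values in the positive elements is positive. -/
lemma exists_star_mul_self_of_forall {B : Type*} [NonUnitalCStarAlgebra B] {K : Type*}
    [TopologicalSpace K] [CompactSpace K] (f : C(K, B)) (hf : ∀ t, ∃ c, f t = star c * c) :
    ∃ g : C(K, B), f = star g * g := by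
  let _ := CStarAlgebra.spectralOrder B
  have := CStarAlgebra.spectralOrderedRing B
  have h0 : ∀ t, 0 ≤ f t := fun t => by
    obtain ⟨c, hc⟩ := hf t
    rw [hc]; exact star_mul_self_nonneg c
  have hc : Continuous fun t => cfcₙ NNReal.sqrt (f t) := by
    refine Continuous.cfcₙ_nnreal_of_mem_nhdsSet (s := Set.univ) NNReal.sqrt Filter.univ_mem
      f.continuous h0 NNReal.continuous_sqrt.continuousOn
  refine ⟨⟨_, hc⟩, ?_⟩
  ext t
  have h1 : IsSelfAdjoint (cfcₙ NNReal.sqrt (f t)) :=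
    .of_nonneg (cfcₙ_predicate NNReal.sqrt (f t))
  change f t = star (cfcₙ NNReal.sqrt (f t)) * cfcₙ NNReal.sqrt (f t)
  rw [h1.star_eq]
  exact (CFC.sqrt_mul_sqrt_self (f t) (h0 t)).symm

section Completion

variable {B T : Type*} [NonUnitalCStarAlgebra B] [SeminormedAddCommGroup T] [NormedSpace ℂ T]
  [HilbertModule B T]

open UniformSpace

variable (B T) in
/-- Continuous extension of the right action to the completion. -/
def complAct : Completion T →L[ℂ] B →L[ℂ] Completion T :=
  ((ContinuousLinearMap.compL ℂ B T (Completion T) Completion.toComplL).comp (actL B T)).extend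
    Completion.toComplL

variable (B T) in
/-- Continuous extension of the inner product to the completion. -/
def complInner : Completion T →L⋆[ℂ] Completion T →L[ℂ] B :=
  (((innerL B T).extend (Completion.toComplL (𝕜 := ℂ) (E := T))).flip.extend
    (Completion.toComplL (𝕜 := ℂ) (E := T))).flip

lemma complAct_coe (x : T) (b : B) : complAct B T (x : Completion T) b = ((x ◃ b : T) : Completion T) := by
  have := ContinuousLinearMap.extend_eq
    ((ContinuousLinearMap.compL ℂ B T (Completion T) Completion.toComplL).comp (actL B T))
    (e := Completion.toComplL (𝕜 := ℂ) (E := T)) Completion.denseRange_coe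
    (Completion.isUniformInducing_coe T) x
  exact congrArg (fun f => f b) this

lemma complInner_coe (x y : T) :
    complInner B T (x : Completion T) (y : Completion T) = ⟪x, y⟫[B] := by
  have h1 := ContinuousLinearMap.extend_eq (innerL B T)
    (e := Completion.toComplL (𝕜 := ℂ) (E := T)) Completion.denseRange_coe
    (Completion.isUniformInducing_coe T) x
  have h2 := ContinuousLinearMap.extend_eq
    ((innerL B T).extend (Completion.toComplL (𝕜 := ℂ) (E := T))).flip
    (e := Completion.toComplL (𝕜 := ℂ) (E := T)) Completion.denseRange_coe
    (Completion.isUniformInducing_coe T) y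
  have h3 := congrArg (fun f => f (x : Completion T)) h2
  have h4 := congrArg (fun f => f y) h1
  exact h3.trans h4

instance completionHilbertModule : HilbertModule B (Completion T) where
  act := ContinuousLinearMap.coeLM ℂ ∘ₗ (complAct B T).toLinearMap
  inner := (ContinuousLinearMap.coeLM ℂ).comp (complInner B T).toLinearMap
  act_act x b c := by
    change complAct B T (complAct B T x b) c = complAct B T x (b * c)
    induction x using Completion.induction_on with
    | hp => exact isClosed_eq (by fun_prop) (by fun_prop)
    | ih x => simp only [complAct_coe, act_act]
  inner_act x y b := by
    change complInner B T x (complAct B T y b) = complInner B T x y * b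
    induction x, y using Completion.induction_on₂ with
    | hp => exact isClosed_eq (by fun_prop) (by fun_prop)
    | ih x y => simp only [complAct_coe, complInner_coe, inner_act]
  star_inner x y := by
    change star (complInner B T x y) = complInner B T y x
    induction x, y using Completion.induction_on₂ with
    | hp => exact isClosed_eq (by fun_prop) (by fun_prop)
    | ih x y => simp only [complInner_coe, star_inner]
  inner_self_pos x := by
    change ∃ c, complInner B T x x = star c * c
    induction x using Completion.induction_on with
    | hp => exact (isClosed_positive B).preimage (f := fun x => complInner B T x x) (by fun_prop)
    | ih x => simpa only [complInner_coe] using inner_self_pos x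
  norm_sq x := by
    change ‖x‖ ^ 2 = ‖complInner B T x x‖
    induction x using Completion.induction_on with
    | hp => exact isClosed_eq (by fun_prop) (by fun_prop)
    | ih x => simpa only [complInner_coe, Completion.norm_coe] using HilbertModule.norm_sq x

lemma completion_act_coe (x : T) (b : B) :
    (x : Completion T) ◃ b = ((x ◃ b : T) : Completion T) := complAct_coe x b

lemma completion_inner_coe (x y : T) :
    ⟪(x : Completion T), (y : Completion T)⟫[B] = ⟪x, y⟫[B] := complInner_coe x y

end Completion

open scoped unitInterval TensorProduct

instance (B : Type*) [NonUnitalCStarAlgebra B] [GradedCStarAlgebra B] :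
    GradedCStarAlgebra C(I, B) where
  grading :=
    { toFun := fun f => ⟨fun t => GradedCStarAlgebra.grading (f t), by
        exact (continuous_grading B).comp f.continuous⟩
      map_smul' := fun c f => by ext t; exact map_smul (GradedCStarAlgebra.grading (A := B)) c (f t)
      map_zero' := by ext t; exact map_zero (GradedCStarAlgebra.grading (A := B))
      map_add' := fun f g => by ext t; exact map_add (GradedCStarAlgebra.grading (A := B)) (f t) (g t)
      map_mul' := fun f g => by ext t; exact map_mul (GradedCStarAlgebra.grading (A := B)) (f t) (g t)
      map_star' := fun f => by ext t; exact map_star (GradedCStarAlgebra.grading (A := B)) (f t) }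
  grading_grading f := by ext t; exact GradedCStarAlgebra.grading_grading (f t)

lemma grading_apply {B : Type*} [NonUnitalCStarAlgebra B] [GradedCStarAlgebra B] (f : C(I, B))
    (t : I) : GradedCStarAlgebra.grading f t = GradedCStarAlgebra.grading (f t) := rfl

/-- A `ℤ/2ℤ`-graded C⋆-correspondence from `A` to `B`: a `ℤ/2ℤ`-graded Hilbert C⋆-module over `B`
with an even `⋆`-homomorphism from `A` to the bounded adjointable operators. -/
structure GradedCorrespondence (A : Type u) (B : Type v) [NonUnitalCStarAlgebra A]
    [NonUnitalCStarAlgebra B] [GradedCStarAlgebra A] [GradedCStarAlgebra B] where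
  carrier : Type w
  [normedAddCommGroup : NormedAddCommGroup carrier]
  [normedSpace : NormedSpace ℂ carrier]
  [completeSpace : CompleteSpace carrier]
  [hilbertModule : HilbertModule B carrier]
  grading : carrier →L[ℂ] carrier
  grading_grading : ∀ x, grading (grading x) = x
  grading_act : ∀ (x : carrier) (b : B),
    grading (x ◃ b) = grading x ◃ GradedCStarAlgebra.grading b
  inner_grading : ∀ x y : carrier,
    ⟪grading x, grading y⟫[B] = GradedCStarAlgebra.grading ⟪x, y⟫[B]
  leftAction : A →ₙₐ[ℂ] (carrier →L[ℂ] carrier)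
  inner_leftAction : ∀ (a : A) (x y : carrier),
    ⟪leftAction a x, y⟫[B] = ⟪x, leftAction (star a) y⟫[B]
  grading_leftAction : ∀ (a : A) (x : carrier),
    grading (leftAction a x) = leftAction (GradedCStarAlgebra.grading a) (grading x)

namespace GradedCorrespondence

attribute [instance] normedAddCommGroup normedSpace completeSpace hilbertModule

instance (A : Type u) (B : Type v) [NonUnitalCStarAlgebra A]
    [NonUnitalCStarAlgebra B] [GradedCStarAlgebra A] [GradedCStarAlgebra B] :
    CoeSort (GradedCorrespondence.{u, v, w} A B) (Type w) := ⟨carrier⟩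

end GradedCorrespondence

section Hilbert

variable {B X : Type*} [NonUnitalCStarAlgebra B] [NormedAddCommGroup X] [NormedSpace ℂ X]
  [HilbertModule B X]

variable (B) in
lemma ext_inner {x y : X} (h : ∀ z, ⟪z, x⟫[B] = ⟪z, y⟫[B]) : x = y := by
  have h0 : ⟪x - y, x - y⟫[B] = 0 := by rw [map_sub (inner (x - y)), h, sub_self]
  have h1 := HilbertModule.norm_sq (B := B) (x - y)
  rw [h0, norm_zero] at h1
  exact sub_eq_zero.mp (norm_eq_zero.mp (pow_eq_zero_iff two_ne_zero |>.mp h1))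

/-- `C([0,1], X)` is a Hilbert C⋆-module over `C([0,1], B)` with the pointwise operations. -/
instance pathHilbertModule : HilbertModule C(I, B) C(I, X) where
  act := LinearMap.mk₂ ℂ
    (fun f φ => ⟨fun t => actL B X (f t) (φ t), by fun_prop⟩)
    (fun f g φ => by ext t; simp) (fun c f φ => by ext t; simp)
    (fun f φ ψ => by ext t; simp) (fun c f φ => by ext t; simp)
  inner := LinearMap.mk₂'ₛₗ (starRingEnd ℂ) (RingHom.id ℂ)
    (fun f g => ⟨fun t => innerL B X (f t) (g t), by fun_prop⟩)
    (fun f g φ => by ext t; simp) (fun c f φ => by ext t; simp [map_smulₛₗ])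
    (fun f φ ψ => by ext t; simp) (fun c f φ => by ext t; simp)
  act_act f φ ψ := by ext t; exact act_act (f t) (φ t) (ψ t)
  inner_act f g φ := by ext t; exact inner_act (f t) (g t) (φ t)
  star_inner f g := by ext t; exact star_inner (f t) (g t)
  inner_self_pos f := exists_star_mul_self_of_forall _ fun t => inner_self_pos (f t)
  norm_sq f := by
    refine le_antisymm ?_ ?_
    · refine (Real.le_sqrt (norm_nonneg _) (norm_nonneg _)).mp ?_
      refine (ContinuousMap.norm_le _ (Real.sqrt_nonneg _)).mpr fun t => ?_
      refine Real.le_sqrt_of_sq_le ?_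
      rw [HilbertModule.norm_sq (B := B) (f t)]
      exact ContinuousMap.norm_coe_le_norm
        (⟨fun t => innerL B X (f t) (f t), by fun_prop⟩ : C(I, B)) t
    · refine (ContinuousMap.norm_le _ (sq_nonneg _)).mpr fun t => ?_
      change ‖⟪f t, f t⟫[B]‖ ≤ _
      rw [← HilbertModule.norm_sq (B := B) (f t)]
      gcongr
      exact ContinuousMap.norm_coe_le_norm f t

lemma path_act_apply (f : C(I, X)) (φ : C(I, B)) (t : I) : (f ◃ φ) t = f t ◃ φ t := rfl

lemma path_inner_apply (f g : C(I, X)) (t : I) : ⟪f, g⟫[C(I, B)] t = ⟪f t, g t⟫[B] := rfl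

end Hilbert

variable {A : Type u} {B : Type v} [NonUnitalCStarAlgebra A] [NonUnitalCStarAlgebra B]
  [GradedCStarAlgebra A] [GradedCStarAlgebra B]

namespace GradedCorrespondence

/-- The graded C⋆-correspondence `C([0,1], X)` from `A` to `C([0,1], B)`, with the pointwise
operations. -/
def path (X : GradedCorrespondence.{u, v, w} A B) : GradedCorrespondence.{u, v, w} A C(I, B) where
  carrier := C(I, X)
  grading := X.grading.compLeftContinuous ℂ I
  grading_grading f := by ext t; exact X.grading_grading (f t)
  grading_act f φ := by ext t; exact X.grading_act (f t) (φ t)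
  inner_grading f g := by ext t; exact X.inner_grading (f t) (g t)
  leftAction :=
    { toFun := fun a => (X.leftAction a).compLeftContinuous ℂ I
      map_smul' := fun c a => by ext f t; simp; rfl
      map_zero' := by ext f t; simp
      map_add' := fun a b => by ext f t; simp; rfl
      map_mul' := fun a b => by ext f t; simp; rfl }
  inner_leftAction a f g := by ext t; exact X.inner_leftAction a (f t) (g t)
  grading_leftAction a f := by ext t; exact X.grading_leftAction a (f t)

lemma leftAction_act (X : GradedCorrespondence.{u, v, w} A B) (a : A) (x : X) (b : B) :
    X.leftAction a (x ◃ b) = X.leftAction a x ◃ b := by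
  refine ext_inner B fun z => ?_
  have h := fun x : X => X.inner_leftAction (star a) z x
  simp only [star_star] at h
  rw [inner_act, ← h, ← h, inner_act]

/-- `⟪a x, a x⟫ ≤ ‖a‖² ⟪x, x⟫`. -/
lemma exists_norm_sq_sub (X : GradedCorrespondence.{u, v, w} A B) (a : A) (x : X) :
    ∃ d : B, (‖a‖ ^ 2) • ⟪x, x⟫[B] - ⟪X.leftAction a x, X.leftAction a x⟫[B] = star d * d := by
  have h1 : (0 : Unitization ℂ A) ≤ algebraMap ℝ (Unitization ℂ A) (‖(a : Unitization ℂ A)‖ ^ 2)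
      - star (a : Unitization ℂ A) * (a : Unitization ℂ A) :=
    sub_nonneg.mpr CStarAlgebra.star_mul_le_algebraMap_norm_sq
  obtain ⟨c, hc⟩ := CStarAlgebra.nonneg_iff_eq_star_mul_self.mp h1
  rw [Unitization.norm_inr] at hc
  set l := c.fst with hl
  set a' := c.snd with ha'
  have hc' : Unitization.inl ((‖a‖ ^ 2 : ℝ) : ℂ)
      = star c * c + star (a : Unitization ℂ A) * (a : Unitization ℂ A) :=
    sub_eq_iff_eq_add.mp hc
  have hfst : ((‖a‖ ^ 2 : ℝ) : ℂ) = star l * l := by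
    simpa using congrArg (fun z => z.fst) hc'
  have hsnd : - (star a * a) = star l • a' + l • star a' + star a' * a' := by
    rw [neg_eq_iff_add_eq_zero, add_comm]
    simpa using (congrArg (fun z => z.snd) hc').symm
  obtain ⟨d, hd⟩ := inner_self_pos (B := B) (l • x + X.leftAction a' x)
  refine ⟨d, hd ▸ ?_⟩
  have h2 : - ⟪X.leftAction a x, X.leftAction a x⟫[B]
      = ⟪x, X.leftAction (-(star a * a)) x⟫[B] := by
    rw [X.inner_leftAction, map_neg, map_mul]; simp
  rw [sub_eq_add_neg, h2, hsnd]
  have h3 : ⟪X.leftAction a' x, X.leftAction a' x⟫[B] = ⟪x, X.leftAction (star a' * a') x⟫[B] := by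
    rw [X.inner_leftAction, map_mul]; rfl
  have h4 := X.inner_leftAction a' x x
  rw [← Complex.coe_smul, hfst, map_add, map_add, map_smul, map_smul]
  simp only [add_apply, smul_apply, pre_inner_add_left, pre_inner_add_right, pre_inner_smul_left,
    pre_inner_smul_right, h3, h4]
  module

/-- The algebraic tensor product underlying the interior tensor product of `Y` and `B` along the
evaluation `ev_t : C([0,1], B) → B`. (Elements `y ◃ f ⊗ b - y ⊗ f t * b` have seminorm zero, so
that balancing over `C([0,1], B)` happens in the completion.) -/
def EvTensor (Y : GradedCorrespondence.{u, v, w} A C(I, B)) (_t : I) : Type (max w v) := Y ⊗[ℂ] B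

section EvTensor

variable (Y : GradedCorrespondence.{u, v, w} A C(I, B)) (t : I)

instance : AddCommGroup (EvTensor Y t) := inferInstanceAs (AddCommGroup (Y ⊗[ℂ] B))

instance : Module ℂ (EvTensor Y t) := inferInstanceAs (Module ℂ (Y ⊗[ℂ] B))

/-- The elementary tensor `y ⊗ b`. -/
def evTmul (y : Y) (b : B) : EvTensor Y t := y ⊗ₜ[ℂ] b

@[elab_as_elim]
lemma EvTensor.induction {p : EvTensor Y t → Prop} (h0 : p 0) (h1 : ∀ y b, p (evTmul Y t y b))
    (h2 : ∀ ξ η, p ξ → p η → p (ξ + η)) (ξ : EvTensor Y t) : p ξ :=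
  TensorProduct.induction_on ξ h0 h1 h2

variable (B) in
/-- The constant functions. -/
def constₗ : B →ₗ[ℂ] C(I, B) where
  toFun b := ContinuousMap.const I b
  map_add' _ _ := rfl
  map_smul' _ _ := rfl

/-- The map `y ⊗ b ↦ y ◃ b`, where `b` is regarded as a constant function. -/
def evTensorMul : EvTensor Y t →ₗ[ℂ] Y :=
  TensorProduct.lift ((PreHilbertModule.act (B := C(I, B)) (X := Y)).compl₂ (constₗ B))

lemma evTensorMul_tmul (y : Y) (b : B) :
    evTensorMul Y t (evTmul Y t y b) = y ◃ ContinuousMap.const I b := rfl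

/-- The right action `(y ⊗ c) ◃ b = y ⊗ c * b`. -/
def evTensorAct : EvTensor Y t →ₗ[ℂ] B →ₗ[ℂ] EvTensor Y t :=
  ((LinearMap.lTensorHom (R := ℂ) Y) ∘ₗ (LinearMap.mul ℂ B).flip).flip

lemma evTensorAct_tmul (y : Y) (c b : B) :
    evTensorAct Y t (evTmul Y t y c) b = evTmul Y t y (c * b) := rfl

lemma evTensorMul_act (ξ : EvTensor Y t) (b : B) :
    evTensorMul Y t (evTensorAct Y t ξ b) = evTensorMul Y t ξ ◃ ContinuousMap.const I b := by
  induction ξ using EvTensor.induction with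
  | h0 => simp
  | h1 y c =>
    rw [evTensorAct_tmul, evTensorMul_tmul, evTensorMul_tmul, act_act]
    rfl
  | h2 ξ η h1 h2 => simp only [map_add, LinearMap.add_apply, h1, h2]

instance : PreHilbertModule B (EvTensor Y t) where
  act := evTensorAct Y t
  inner := LinearMap.mk₂'ₛₗ (starRingEnd ℂ) (RingHom.id ℂ)
    (fun ξ η => ⟪evTensorMul Y t ξ, evTensorMul Y t η⟫[C(I, B)] t)
    (fun ξ η ζ => by rw [map_add, pre_inner_add_left]; rfl)
    (fun c ξ η => by rw [map_smul, pre_inner_smul_left]; rfl)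
    (fun ξ η ζ => by rw [map_add, pre_inner_add_right]; rfl)
    (fun c ξ η => by rw [map_smul, pre_inner_smul_right]; rfl)
  act_act ξ b c := by
    induction ξ using EvTensor.induction with
    | h0 => simp
    | h1 y d => simp only [evTensorAct_tmul, mul_assoc]
    | h2 ξ η h1 h2 => simp only [map_add, LinearMap.add_apply, h1, h2]
  inner_act ξ η b := by
    change ⟪evTensorMul Y t ξ, evTensorMul Y t (evTensorAct Y t η b)⟫[C(I, B)] t = _
    rw [evTensorMul_act, inner_act]
    rfl
  star_inner ξ η := by
    change star (⟪evTensorMul Y t ξ, evTensorMul Y t η⟫[C(I, B)] t) = _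
    rw [← ContinuousMap.star_apply, star_inner]
    rfl
  inner_self_pos ξ := by
    obtain ⟨c, hc⟩ := inner_self_pos (B := C(I, B)) (evTensorMul Y t ξ)
    exact ⟨c t, congrArg (fun f => f t) hc⟩

lemma evTensor_inner (ξ η : EvTensor Y t) :
    ⟪ξ, η⟫[B] = ⟪evTensorMul Y t ξ, evTensorMul Y t η⟫[C(I, B)] t := rfl

/-- The inner product on elementary tensors:
`⟪y ⊗ b, z ⊗ c⟫ = b⋆ ev_t(⟪y, z⟫) c`. -/
lemma evTensor_inner_tmul (y z : Y) (b c : B) :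
    ⟪evTmul Y t y b, evTmul Y t z c⟫[B] = star b * ⟪y, z⟫[C(I, B)] t * c := by
  rw [evTensor_inner, evTensorMul_tmul, evTensorMul_tmul, inner_act, inner_act_left]
  rfl

lemma evTensor_act_tmul (y : Y) (b c : B) : evTmul Y t y b ◃ c = evTmul Y t y (b * c) := rfl

instance : SeminormedAddCommGroup (EvTensor Y t) :=
  (PreHilbertModule.toAddGroupSeminorm B (EvTensor Y t)).toSeminormedAddCommGroup

lemma evTensor_norm (ξ : EvTensor Y t) : ‖ξ‖ = √‖⟪ξ, ξ⟫[B]‖ := rfl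

instance : NormedSpace ℂ (EvTensor Y t) where
  norm_smul_le c ξ := by
    rw [evTensor_norm, evTensor_norm, pre_inner_smul_left, pre_inner_smul_right, norm_smul,
      norm_smul, norm_star, ← mul_assoc, Real.sqrt_mul (by positivity),
      Real.sqrt_mul_self (norm_nonneg c)]

instance : HilbertModule B (EvTensor Y t) where
  norm_sq ξ := by rw [evTensor_norm, Real.sq_sqrt (norm_nonneg _)]

/-- The extension to the completion of a bounded linear map. -/
def complMap {T : Type*} [SeminormedAddCommGroup T] [NormedSpace ℂ T] (f : T →L[ℂ] T) :
    UniformSpace.Completion T →L[ℂ] UniformSpace.Completion T :=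
  (UniformSpace.Completion.toComplL.comp f).extend UniformSpace.Completion.toComplL

lemma complMap_coe {T : Type*} [SeminormedAddCommGroup T] [NormedSpace ℂ T] (f : T →L[ℂ] T)
    (x : T) : complMap f (x : UniformSpace.Completion T) = (f x : UniformSpace.Completion T) :=
  ContinuousLinearMap.extend_eq (UniformSpace.Completion.toComplL.comp f)
    UniformSpace.Completion.denseRange_coe (UniformSpace.Completion.isUniformInducing_coe T) x

lemma completion_clm_ext {T : Type*} [SeminormedAddCommGroup T] [NormedSpace ℂ T]
    {f g : UniformSpace.Completion T →L[ℂ] UniformSpace.Completion T}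
    (h : ∀ x : T, f (x : UniformSpace.Completion T) = g (x : UniformSpace.Completion T)) :
    f = g := by
  ext x
  induction x using UniformSpace.Completion.induction_on with
  | hp => exact isClosed_eq (by fun_prop) (by fun_prop)
  | ih x => exact h x

/-- The operator `γ_Y ⊗ γ_B`. -/
def evTensorGradingₗ : EvTensor Y t →ₗ[ℂ] EvTensor Y t :=
  TensorProduct.map (Y.grading : Y →ₗ[ℂ] Y)
    (LinearMapClass.linearMap (GradedCStarAlgebra.grading (A := B)))

lemma evTensorGradingₗ_tmul (y : Y) (b : B) : evTensorGradingₗ Y t (evTmul Y t y b) =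
    evTmul Y t (Y.grading y) (GradedCStarAlgebra.grading b) := rfl

lemma evTensorMul_grading (ξ : EvTensor Y t) :
    evTensorMul Y t (evTensorGradingₗ Y t ξ) = Y.grading (evTensorMul Y t ξ) := by
  induction ξ using EvTensor.induction with
  | h0 => simp
  | h1 y b =>
    rw [evTensorGradingₗ_tmul, evTensorMul_tmul, evTensorMul_tmul, Y.grading_act]
    rfl
  | h2 ξ η h1 h2 => simp only [map_add, h1, h2]

lemma evTensor_inner_grading (ξ η : EvTensor Y t) :
    ⟪evTensorGradingₗ Y t ξ, evTensorGradingₗ Y t η⟫[B] = GradedCStarAlgebra.grading ⟪ξ, η⟫[B] := by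
  rw [evTensor_inner, evTensorMul_grading, evTensorMul_grading, Y.inner_grading]
  rfl

/-- The grading operator `γ_Y ⊗ γ_B` on the algebraic tensor product. -/
def evTensorGrading : EvTensor Y t →L[ℂ] EvTensor Y t :=
  (evTensorGradingₗ Y t).mkContinuous 1 fun ξ => by
    rw [one_mul, evTensor_norm, evTensor_norm, evTensor_inner_grading]
    exact Real.sqrt_le_sqrt
      (NonUnitalStarAlgHom.norm_apply_le (GradedCStarAlgebra.grading (A := B)) _)

lemma evTensorGrading_tmul (y : Y) (b : B) : evTensorGrading Y t (evTmul Y t y b) =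
    evTmul Y t (Y.grading y) (GradedCStarAlgebra.grading b) := rfl

/-- The operator `a ⊗ 1`. -/
def evTensorLeftₗ (a : A) : EvTensor Y t →ₗ[ℂ] EvTensor Y t :=
  LinearMap.rTensor B (Y.leftAction a : Y →ₗ[ℂ] Y)

lemma evTensorLeftₗ_tmul (a : A) (y : Y) (b : B) : evTensorLeftₗ Y t a (evTmul Y t y b) =
    evTmul Y t (Y.leftAction a y) b := rfl

lemma evTensorMul_left (a : A) (ξ : EvTensor Y t) :
    evTensorMul Y t (evTensorLeftₗ Y t a ξ) = Y.leftAction a (evTensorMul Y t ξ) := by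
  induction ξ using EvTensor.induction with
  | h0 => simp
  | h1 y b => rw [evTensorLeftₗ_tmul, evTensorMul_tmul, evTensorMul_tmul, Y.leftAction_act]
  | h2 ξ η h1 h2 => simp only [map_add, h1, h2]

/-- The left action `a ⊗ 1` on the algebraic tensor product. -/
def evTensorLeft (a : A) : EvTensor Y t →L[ℂ] EvTensor Y t :=
  (evTensorLeftₗ Y t a).mkContinuous ‖a‖ fun ξ => by
    let _ := CStarAlgebra.spectralOrder B
    have := CStarAlgebra.spectralOrderedRing B
    obtain ⟨d, hd⟩ := Y.exists_norm_sq_sub a (evTensorMul Y t ξ)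
    have h1 := congrArg (fun f => f t) hd
    have h2 : ⟪evTensorLeftₗ Y t a ξ, evTensorLeftₗ Y t a ξ⟫[B] ≤ (‖a‖ ^ 2) • ⟪ξ, ξ⟫[B] := by
      rw [evTensor_inner, evTensor_inner, evTensorMul_left]
      refine sub_nonneg.mp ?_
      have h3 : (0 : B) ≤ star (d t) * d t := star_mul_self_nonneg _
      exact h3.trans_eq h1.symm
    have h4 : (0 : B) ≤ ⟪evTensorLeftₗ Y t a ξ, evTensorLeftₗ Y t a ξ⟫[B] := by
      obtain ⟨c, hc⟩ := inner_self_pos (B := B) (evTensorLeftₗ Y t a ξ)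
      rw [hc]; exact star_mul_self_nonneg c
    have h5 := CStarAlgebra.norm_le_norm_of_nonneg_of_le h4 h2
    rw [norm_smul, Real.norm_of_nonneg (by positivity)] at h5
    rw [evTensor_norm, evTensor_norm]
    refine (Real.sqrt_le_sqrt h5).trans_eq ?_
    rw [Real.sqrt_mul (by positivity), Real.sqrt_sq (norm_nonneg a)]

lemma evTensorLeft_tmul (a : A) (y : Y) (b : B) : evTensorLeft Y t a (evTmul Y t y b) =
    evTmul Y t (Y.leftAction a y) b := rfl

/-- The interior tensor product `Y ⊗ B` along the evaluation `ev_t : C([0,1], B) → B`: the completion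
of the algebraic tensor product in the inner product `⟪y ⊗ b, z ⊗ c⟫ = b⋆ ev_t(⟪y, z⟫) c`, graded by
`γ_Y ⊗ γ_B` and with the left action of `a` by `a ⊗ 1`. -/
def ev : GradedCorrespondence.{u, v, max w v} A B where
  carrier := UniformSpace.Completion (EvTensor Y t)
  grading := complMap (evTensorGrading Y t)
  grading_grading x := by
    induction x using UniformSpace.Completion.induction_on with
    | hp => exact isClosed_eq (by fun_prop) (by fun_prop)
    | ih ξ =>
      rw [complMap_coe, complMap_coe]
      congr 1
      induction ξ using EvTensor.induction with
      | h0 => simp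
      | h1 y b =>
        rw [evTensorGrading_tmul, evTensorGrading_tmul, Y.grading_grading, GradedCStarAlgebra.grading_grading]
      | h2 ξ η h1 h2 => simp only [map_add, h1, h2]
  grading_act x b := by
    change complMap (evTensorGrading Y t) (actL B _ x b) =
      actL B _ (complMap (evTensorGrading Y t) x) _
    induction x using UniformSpace.Completion.induction_on with
    | hp => exact isClosed_eq (by fun_prop) (by fun_prop)
    | ih ξ =>
      rw [actL_apply, completion_act_coe, complMap_coe, complMap_coe, actL_apply,
        completion_act_coe]
      congr 1
      induction ξ using EvTensor.induction with
      | h0 => simp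
      | h1 y c =>
        rw [evTensor_act_tmul, evTensorGrading_tmul, evTensorGrading_tmul, evTensor_act_tmul,
          map_mul]
      | h2 ξ η h1 h2 => simp only [map_add, LinearMap.add_apply, h1, h2]
  inner_grading x y := by
    change innerL B _ (complMap (evTensorGrading Y t) x) (complMap (evTensorGrading Y t) y) =
      GradedCStarAlgebra.grading (innerL B _ x y)
    have hc := continuous_grading B
    induction x, y using UniformSpace.Completion.induction_on₂ with
    | hp => exact isClosed_eq (by fun_prop) (by fun_prop)
    | ih ξ η =>
      rw [complMap_coe, complMap_coe, innerL_apply, innerL_apply, completion_inner_coe,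
        completion_inner_coe]
      exact evTensor_inner_grading Y t ξ η
  leftAction :=
    { toFun := fun a => complMap (evTensorLeft Y t a)
      map_smul' := fun c a => completion_clm_ext fun ξ => by
        rw [complMap_coe, smul_apply, complMap_coe,
          ← UniformSpace.Completion.coe_smul]
        congr 1
        change evTensorLeftₗ Y t _ ξ = c • evTensorLeftₗ Y t _ ξ
        rw [evTensorLeftₗ, map_smul, ContinuousLinearMap.toLinearMap_smul, LinearMap.rTensor_smul]
        rfl
      map_zero' := completion_clm_ext fun ξ => by
        rw [complMap_coe, zero_apply, ← UniformSpace.Completion.coe_zero]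
        congr 1
        change evTensorLeftₗ Y t _ ξ = 0
        rw [evTensorLeftₗ, map_zero, ContinuousLinearMap.toLinearMap_zero, LinearMap.rTensor_zero]
        rfl
      map_add' := fun a b => completion_clm_ext fun ξ => by
        rw [complMap_coe, add_apply, complMap_coe, complMap_coe,
          ← UniformSpace.Completion.coe_add]
        congr 1
        change evTensorLeftₗ Y t _ ξ = evTensorLeftₗ Y t _ ξ + evTensorLeftₗ Y t _ ξ
        rw [evTensorLeftₗ, map_add, ContinuousLinearMap.toLinearMap_add, LinearMap.rTensor_add]
        rfl
      map_mul' := fun a b => completion_clm_ext fun ξ => by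
        rw [complMap_coe, mul_apply_eq_comp, complMap_coe, complMap_coe]
        congr 1
        induction ξ using EvTensor.induction with
        | h0 => simp
        | h1 y c =>
          rw [evTensorLeft_tmul, evTensorLeft_tmul, evTensorLeft_tmul, map_mul]
          rfl
        | h2 ξ η h1 h2 => simp only [map_add, h1, h2] }
  inner_leftAction a x y := by
    change innerL B _ (complMap (evTensorLeft Y t a) x) y =
      innerL B _ x (complMap (evTensorLeft Y t (star a)) y)
    induction x, y using UniformSpace.Completion.induction_on₂ with
    | hp => exact isClosed_eq (by fun_prop) (by fun_prop)
    | ih ξ η =>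
      rw [complMap_coe, complMap_coe, innerL_apply, innerL_apply, completion_inner_coe,
        completion_inner_coe, evTensor_inner, evTensor_inner]
      change ⟪evTensorMul Y t (evTensorLeftₗ Y t a ξ), _⟫[C(I, B)] t =
        ⟪_, evTensorMul Y t (evTensorLeftₗ Y t (star a) η)⟫[C(I, B)] t
      rw [evTensorMul_left, evTensorMul_left, Y.inner_leftAction]
  grading_leftAction a x := by
    change complMap (evTensorGrading Y t) (complMap (evTensorLeft Y t a) x) =
      complMap (evTensorLeft Y t _) (complMap (evTensorGrading Y t) x)
    induction x using UniformSpace.Completion.induction_on with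
    | hp => exact isClosed_eq (by fun_prop) (by fun_prop)
    | ih ξ =>
      simp only [complMap_coe]
      congr 1
      induction ξ using EvTensor.induction with
      | h0 => simp
      | h1 y c =>
        rw [evTensorLeft_tmul, evTensorGrading_tmul, evTensorGrading_tmul, evTensorLeft_tmul,
          Y.grading_leftAction]
      | h2 ξ η h1 h2 => simp only [map_add, h1, h2]

/-- The elementary tensor `y ⊗ b` in the interior tensor product. -/
def evMk (y : Y) (b : B) : Y.ev t := ((evTmul Y t y b : EvTensor Y t) : UniformSpace.Completion _)

/-- The operator `E ⊗ 1` on the interior tensor product: the closure of the operator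
`y ⊗ b ↦ E y ⊗ b` defined on the span of the elementary tensors `y ⊗ b` with `y` in the domain
of `E`. -/
def evOperator (E : Y →ₗ.[ℂ] Y) : Y.ev t →ₗ.[ℂ] Y.ev t :=
  (Submodule.span ℂ {p : Y.ev t × Y.ev t | ∃ (y : E.domain) (b : B),
    p = (Y.evMk t y b, Y.evMk t (E y) b)}).topologicalClosure.toLinearPMap

end EvTensor

end GradedCorrespondence

/-- A C⋆-algebra is σ-unital when it has a countable approximate identity. -/
def IsSigmaUnital (B : Type*) [NonUnitalCStarAlgebra B] : Prop :=
  ∃ e : ℕ → B, ∀ b, Filter.Tendsto (fun n => e n * b) Filter.atTop (nhds b) ∧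
    Filter.Tendsto (fun n => b * e n) Filter.atTop (nhds b)

namespace GradedCorrespondence

variable (X : GradedCorrespondence.{u, v, w} A B)

/-- `X` is countably generated as a Hilbert C⋆-module over `B`. -/
def IsCountablyGenerated : Prop :=
  ∃ S : Set X, S.Countable ∧
    Dense (Submodule.span ℂ {z : X | ∃ x ∈ S, ∃ b : B, z = x ◃ b} : Set X)

/-- The compact operators on `X`: the closed linear span of the operators `z ↦ x ◃ ⟪y, z⟫`. -/
def compactOperators : Submodule ℂ (X →L[ℂ] X) :=
  (Submodule.span ℂ {θ : X →L[ℂ] X | ∃ x y : X, ∀ z, θ z = x ◃ ⟪y, z⟫[B]}).topologicalClosure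

variable {X}

/-- `D` is a right `B`-linear operator. -/
def IsRightLinear (D : X →ₗ.[ℂ] X) : Prop :=
  ∀ (x : D.domain) (b : B), ∃ h : (x : X) ◃ b ∈ D.domain, D ⟨(x : X) ◃ b, h⟩ = D x ◃ b

/-- The graph of the adjoint of a densely defined operator `D`: the pairs `(y, z)` with
`⟪D x, y⟫ = ⟪x, z⟫` for all `x` in the domain of `D`. -/
def adjointGraph (D : X →ₗ.[ℂ] X) : Set (X × X) :=
  {p | ∀ x : D.domain, ⟪D x, p.1⟫[B] = ⟪(x : X), p.2⟫[B]}

/-- `D` is selfadjoint: it is densely defined and `D⋆ = D`. -/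
def IsSelfAdjointOperator (D : X →ₗ.[ℂ] X) : Prop :=
  Dense (D.domain : Set X) ∧ adjointGraph D = D.graph

/-- `D` is regular: it is closed and densely defined, its adjoint is densely defined, and
`1 + D⋆ D` has dense range. -/
def IsRegularOperator (D : X →ₗ.[ℂ] X) : Prop :=
  D.IsClosed ∧ Dense (D.domain : Set X) ∧ Dense (Prod.fst '' adjointGraph D) ∧
    Dense {w : X | ∃ x y z, (x, y) ∈ D.graph ∧ (y, z) ∈ adjointGraph D ∧ w = x + z}

/-- `D` is odd: the grading operator preserves the domain of `D` and anticommutes with `D`. -/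
def IsOddOperator (D : X →ₗ.[ℂ] X) : Prop :=
  ∀ x : D.domain, ∃ h : X.grading x ∈ D.domain, D ⟨X.grading x, h⟩ = -X.grading (D x)

/-- `R = (i + D)⁻¹`. -/
def IsResolvent (D : X →ₗ.[ℂ] X) (R : X →L[ℂ] X) : Prop :=
  (∀ x : X, ∃ h : R x ∈ D.domain, Complex.I • R x + D ⟨R x, h⟩ = x) ∧
    ∀ x : D.domain, R (Complex.I • (x : X) + D x) = x

variable (X) in
/-- `(X, D)` is an unbounded Kasparov module from the graded `⋆`-subalgebra `𝒜` of `A` to `B`.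
For odd `D` and arbitrary `a` the graded commutator is `[D, a] = D a - γ(a) D`, that is, `D a - a D`
for `a` even and `D a + a D` for `a` odd. -/
structure IsUnboundedKasparovModule (𝒜 : NonUnitalStarSubalgebra ℂ A) (D : X →ₗ.[ℂ] X) : Prop where
  isCountablyGenerated : X.IsCountablyGenerated
  isRightLinear : IsRightLinear D
  isOdd : IsOddOperator D
  isSelfAdjoint : IsSelfAdjointOperator D
  isRegular : IsRegularOperator D
  leftAction_mem_domain : ∀ a ∈ 𝒜, ∀ x : D.domain, X.leftAction a x ∈ D.domain
  commutator : ∀ a ∈ 𝒜, ∃ d : X →L[ℂ] X, ∀ (x : D.domain) (h : X.leftAction a x ∈ D.domain),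
    D ⟨X.leftAction a x, h⟩ - X.leftAction (GradedCStarAlgebra.grading a) (D x) = d x
  resolvent : ∃ R : X →L[ℂ] X, IsResolvent D R ∧
    ∀ a ∈ 𝒜, X.leftAction a ∘L R ∈ X.compactOperators

/-- `(X, D)` and `(X', D')` are unitarily equivalent: there is an even unitary isomorphism of graded
C⋆-correspondences `U` with `U D U⋆ = D'`. -/
def UnitarilyEquivalent {X : GradedCorrespondence.{u, v, w} A B}
    {X' : GradedCorrespondence.{u, v, z} A B} (D : X →ₗ.[ℂ] X) (D' : X' →ₗ.[ℂ] X') : Prop :=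
  ∃ U : X ≃ₗ[ℂ] X',
    (∀ (x : X) (b : B), U (x ◃ b) = U x ◃ b) ∧
    (∀ x y : X, ⟪U x, U y⟫[B] = ⟪x, y⟫[B]) ∧
    (∀ x : X, U (X.grading x) = X'.grading (U x)) ∧
    (∀ (a : A) (x : X), U (X.leftAction a x) = X'.leftAction a (U x)) ∧
    ∀ x y : X, (x, y) ∈ D.graph ↔ (U x, U y) ∈ D'.graph

/-- The unbounded Kasparov module `(Y, E)` from `𝒜` to `C([0,1], B)` is a homotopy from `(X₀, D₀)` to
`(X₁, D₁)`. -/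
def IsHomotopy (𝒜 : NonUnitalStarSubalgebra ℂ A) {Y : GradedCorrespondence.{u, v, z} A C(I, B)}
    (E : Y →ₗ.[ℂ] Y) {X₀ X₁ : GradedCorrespondence.{u, v, w} A B} (D₀ : X₀ →ₗ.[ℂ] X₀)
    (D₁ : X₁ →ₗ.[ℂ] X₁) : Prop :=
  Y.IsUnboundedKasparovModule 𝒜 E ∧
    UnitarilyEquivalent (Y.evOperator 0 E) D₀ ∧ UnitarilyEquivalent (Y.evOperator 1 E) D₁

/-- `(X₀, D₀)` and `(X₁, D₁)` are homotopic. -/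
def Homotopic (𝒜 : NonUnitalStarSubalgebra ℂ A) {X₀ X₁ : GradedCorrespondence.{u, v, w} A B}
    (D₀ : X₀ →ₗ.[ℂ] X₀) (D₁ : X₁ →ₗ.[ℂ] X₁) : Prop :=
  ∃ (Y : GradedCorrespondence.{u, v, w} A C(I, B)) (E : Y →ₗ.[ℂ] Y), IsHomotopy 𝒜 E D₀ D₁

/-- The operator `D + T` with the domain of `D`. -/
def boundedPerturbation (D : X →ₗ.[ℂ] X) (T : X →L[ℂ] X) : X →ₗ.[ℂ] X := (T : X →ₗ[ℂ] X) +ᵥ D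

/-- The operator `(E ξ)(t) = (D + t T) ξ(t)` on `C([0,1], X)`, defined on those `ξ` with values in
the domain of `D` for which `t ↦ D ξ(t)` is continuous. -/
def pathOperator (D : X →ₗ.[ℂ] X) (T : X →L[ℂ] X) : X.path →ₗ.[ℂ] X.path :=
  let E : C(I, X) →ₗ.[ℂ] C(I, X) :=
    { domain :=
        { carrier := {ξ | ∃ h : ∀ t, ξ t ∈ D.domain, Continuous fun t => D ⟨ξ t, h t⟩}
          zero_mem' := ⟨fun _ => D.domain.zero_mem,
            (continuous_const (y := (0 : X))).congr fun _ => D.map_zero.symm⟩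
          add_mem' := fun {ξ η} ⟨h, hc⟩ ⟨k, kc⟩ => ⟨fun t => D.domain.add_mem (h t) (k t), by
            refine (hc.add kc).congr fun t => ?_
            exact (D.map_add ⟨ξ t, h t⟩ ⟨η t, k t⟩).symm⟩
          smul_mem' := fun c ξ ⟨h, hc⟩ => ⟨fun t => D.domain.smul_mem c (h t), by
            refine (hc.const_smul c).congr fun t => ?_
            exact (D.map_smul c ⟨ξ t, h t⟩).symm⟩ }
      toFun :=
        { toFun := fun ξ => ⟨fun t => D ⟨ξ.1 t, ξ.2.choose t⟩ + (t : ℝ) • T (ξ.1 t),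
            ξ.2.choose_spec.add (continuous_subtype_val.smul (T.continuous.comp ξ.1.continuous))⟩
          map_add' := fun ξ η => by
            ext t
            have h := D.map_add ⟨ξ.1 t, ξ.2.choose t⟩ ⟨η.1 t, η.2.choose t⟩
            change D ⟨ξ.1 t + η.1 t, _⟩ + (t : ℝ) • T (ξ.1 t + η.1 t) =
              D ⟨ξ.1 t, _⟩ + (t : ℝ) • T (ξ.1 t) + (D ⟨η.1 t, _⟩ + (t : ℝ) • T (η.1 t))
            rw [AddMemClass.mk_add_mk] at h
            rw [h, map_add, smul_add]
            abel
          map_smul' := fun c ξ => by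
            ext t
            have h := D.map_smul c ⟨ξ.1 t, ξ.2.choose t⟩
            change D ⟨c • ξ.1 t, _⟩ + (t : ℝ) • T (c • ξ.1 t) =
              c • (D ⟨ξ.1 t, _⟩ + (t : ℝ) • T (ξ.1 t))
            rw [SetLike.mk_smul_mk] at h
            rw [h, map_smul, smul_add, smul_comm c (t : ℝ)] } }
  E

end GradedCorrespondence

end UnboundedKK

end

open UnboundedKK UnboundedKK.GradedCorrespondence

/-! Everything about an odd symmetric operator `D` is read off from one bounded `R` with `(i + D) R
= 1`. Symmetry gives `⟪(i + D)x, (i + D)x⟫ = ⟪x, x⟫ + ⟪Dx, Dx⟫`, so `i + D` is bounded below by 1: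
`R` is automatically a two-sided inverse and a contraction. Oddness gives `(D - i)⁻¹ = -γRγ` for the
grading operator `γ`, so the second half-plane comes for free. With both inverses, density of the
domain gives selfadjointness (`IsResolvent.isSelfAdjointOperator`), and `1 + D² = (D - i)(D + i)`
gives regularity (`IsResolvent.isRegularOperator`).

Adding a bounded odd symmetric `T` keeps such a resolvent: `i + D + T = (1 + TR)(i + D)` is inverted
by a Neumann series if `‖T‖ < 1`, and a general `T` is added in `n > ‖T‖` equal steps, every
intermediate resolvent being again a contraction. Compactness of `a (i + D + T)⁻¹` follows from the
second resolvent identity. This is `IsUnboundedKasparovModule.boundedPerturbation`.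

For the homotopy, the constant family `D` on `C([0,1], X)` is a Kasparov module because its
resolvent is `R` applied pointwise (`IsUnboundedKasparovModule.path`). The operator `E` is this one
plus the bounded operator `ξ ↦ (t ↦ t T ξ(t))`, so the perturbation theorem applies once more and no
continuity of `t ↦ (i + D + tT)⁻¹` has to be studied. At the endpoints, `ξ ⊗ b ↦ ξ(t) b` is a
unitary onto `X` which carries the closed operator `E ⊗ 1` to `D + tT`
(`unitarilyEquivalent_evOperator_pathOperator`). An approximate unit of `B` yields both its
surjectivity and the fact that the closure fills the whole graph. -/

noncomputable section

namespace UnboundedKK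

open PreHilbertModule
open scoped unitInterval TensorProduct Topology
open Filter

/-! ### Positivity and approximate units -/

section Positive

variable {B : Type*} [NonUnitalCStarAlgebra B]

lemma norm_le_norm_star_mul_self_add (c d : B) :
    ‖star c * c‖ ≤ ‖star c * c + star d * d‖ := by
  let _ := CStarAlgebra.spectralOrder B
  have := CStarAlgebra.spectralOrderedRing B
  exact CStarAlgebra.norm_le_norm_of_nonneg_of_le (star_mul_self_nonneg c)
    (le_add_of_nonneg_right (star_mul_self_nonneg d))

/-- For `‖b‖ ≤ 1`, expanding the inner product gives `‖x ◃ b - x‖² ≤ 2 ‖⟪x, x⟫ b - ⟪x, x⟫‖`, which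
tends to 0 along the canonical approximate unit of `B`. The filter does not depend on `x`, so pairs
of vectors can be approximated simultaneously. -/
lemma exists_tendsto_act (B : Type*) [NonUnitalCStarAlgebra B] :
    ∃ l : Filter B, l.NeBot ∧ ∀ (X : Type w) [SeminormedAddCommGroup X] [NormedSpace ℂ X]
      [HilbertModule B X], ∀ x : X, Tendsto (fun b : B => x ◃ b) l (𝓝 x) := by
  let _ := CStarAlgebra.spectralOrder B
  have := CStarAlgebra.spectralOrderedRing B
  have hl := CStarAlgebra.increasingApproximateUnit B
  refine ⟨_, hl.neBot, fun X _ _ _ x => ?_⟩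
  have h1 := (hl.tendsto_mul_left ⟪x, x⟫[B])
  rw [tendsto_iff_norm_sub_tendsto_zero] at h1 ⊢
  have h2 : Tendsto (fun b : B => √(2 * ‖⟪x, x⟫[B] * b - ⟪x, x⟫[B]‖))
      (CStarAlgebra.approximateUnit B) (𝓝 0) := by
    simpa using (h1.const_mul 2).sqrt
  refine squeeze_zero' (Eventually.of_forall fun _ => norm_nonneg _) ?_ h2
  filter_upwards [hl.eventually_norm] with b hb
  refine Real.le_sqrt_of_sq_le ?_
  rw [HilbertModule.norm_sq (B := B)]
  have e : ⟪x ◃ b - x, x ◃ b - x⟫[B] =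
      star b * (⟪x, x⟫[B] * b - ⟪x, x⟫[B]) - (⟪x, x⟫[B] * b - ⟪x, x⟫[B]) := by
    rw [map_sub, map_sub, LinearMap.sub_apply, LinearMap.sub_apply, inner_act_left,
      inner_act_left, inner_act, mul_sub]
    abel
  rw [e]
  refine (norm_sub_le _ _).trans ?_
  rw [two_mul]
  gcongr
  refine (norm_mul_le _ _).trans ?_
  rw [norm_star]
  exact mul_le_of_le_one_left (norm_nonneg _) hb

end Positive

/-! ### Density in spaces of paths -/

section Dense

variable {E : Type*} [NormedAddCommGroup E] [NormedSpace ℂ E]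

/-- The Bernstein approximations of a path are finite sums of scalar functions times constant
vectors, and they converge uniformly. Density of `V` then allows those vectors to be arbitrary in
`E`. -/
lemma dense_of_smul_const_mem {V : Set E} (hV : Dense V) (W : Submodule ℂ C(I, E))
    (hW : ∀ (φ : C(I, ℝ)) (v : E), v ∈ V → (φ • ContinuousMap.const I v : C(I, E)) ∈ W) :
    Dense (W : Set C(I, E)) := by
  have h1 : ∀ (φ : C(I, ℝ)) (v : E), (φ • ContinuousMap.const I v : C(I, E)) ∈
      W.topologicalClosure := by
    intro φ v
    refine hV.induction (P := fun v => (φ • ContinuousMap.const I v : C(I, E)) ∈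
      W.topologicalClosure) (fun v hv => W.le_topologicalClosure (hW φ v hv)) ?_ v
    have : Continuous fun v : E => (φ • ContinuousMap.const I v : C(I, E)) := by
      refine ContinuousMap.continuous_of_continuous_uncurry _ ?_
      change Continuous fun p : E × I => φ p.2 • p.1
      fun_prop
    exact W.isClosed_topologicalClosure.preimage this
  intro f
  have h2 := bernsteinApproximation_uniform f
  rw [← Submodule.topologicalClosure_coe]
  refine W.isClosed_topologicalClosure.mem_of_tendsto h2 (Eventually.of_forall fun n => ?_)
  exact Submodule.sum_mem _ fun k _ => h1 _ _

end Dense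

variable {A : Type u} {B : Type v} [NonUnitalCStarAlgebra A] [NonUnitalCStarAlgebra B]
  [GradedCStarAlgebra A] [GradedCStarAlgebra B]

namespace GradedCorrespondence

variable {X : GradedCorrespondence.{u, v, w} A B} {D : X →ₗ.[ℂ] X} {R T : X →L[ℂ] X}

/-! ### Operator conditions in terms of graphs -/

section GraphCharacterizations

lemma forall_mem_graph_iff {p : X → X → Prop} :
    (∀ x y, (x, y) ∈ D.graph → p x y) ↔ ∀ x : D.domain, p x (D x) := by
  refine ⟨fun h x => h _ _ (D.mem_graph x), fun h x y hxy => ?_⟩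
  obtain ⟨z, rfl, rfl⟩ := (LinearPMap.mem_graph_iff _).mp hxy
  exact h z

lemma mk_mem_graph_iff {x y : X} : (x, y) ∈ D.graph ↔ ∃ h : x ∈ D.domain, D ⟨x, h⟩ = y := by
  rw [LinearPMap.mem_graph_iff]
  exact ⟨fun ⟨z, hz, hy⟩ => by subst hz; exact ⟨z.2, hy⟩, fun ⟨h, hy⟩ => ⟨⟨x, h⟩, rfl, hy⟩⟩

lemma isRightLinear_iff :
    IsRightLinear D ↔ ∀ x y, (x, y) ∈ D.graph → ∀ b : B, (x ◃ b, y ◃ b) ∈ D.graph := by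
  rw [forall_mem_graph_iff (p := fun x y => ∀ b : B, (x ◃ b, y ◃ b) ∈ D.graph)]
  simp only [mk_mem_graph_iff, IsRightLinear]

lemma isOddOperator_iff :
    IsOddOperator D ↔ ∀ x y, (x, y) ∈ D.graph → (X.grading x, -X.grading y) ∈ D.graph := by
  rw [forall_mem_graph_iff (p := fun x y => (X.grading x, -X.grading y) ∈ D.graph)]
  simp only [mk_mem_graph_iff, IsOddOperator]

lemma isResolvent_iff : IsResolvent D R ↔ (∀ x, (R x, x - Complex.I • R x) ∈ D.graph) ∧
    ∀ x y, (x, y) ∈ D.graph → R (Complex.I • x + y) = x := by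
  rw [forall_mem_graph_iff (p := fun x y => R (Complex.I • x + y) = x)]
  simp only [mk_mem_graph_iff, IsResolvent, eq_sub_iff_add_eq']

lemma mem_adjointGraph_iff {p : X × X} :
    p ∈ adjointGraph D ↔ ∀ x y, (x, y) ∈ D.graph → ⟪y, p.1⟫[B] = ⟪x, p.2⟫[B] := by
  rw [forall_mem_graph_iff (p := fun x y => ⟪y, p.1⟫[B] = ⟪x, p.2⟫[B])]
  rfl

lemma mem_graph_boundedPerturbation_iff {x y : X} :
    (x, y) ∈ (boundedPerturbation D T).graph ↔ (x, y - T x) ∈ D.graph := by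
  simp only [mk_mem_graph_iff, eq_sub_iff_add_eq']
  rfl

end GraphCharacterizations

/-! ### Resolvents of symmetric operators and their bounded perturbations -/

lemma boundedPerturbation_zero : boundedPerturbation D 0 = D :=
  LinearPMap.eq_of_eq_graph <| by
    ext ⟨x, y⟩; rw [mem_graph_boundedPerturbation_iff]; simp

lemma boundedPerturbation_boundedPerturbation (S : X →L[ℂ] X) :
    boundedPerturbation (boundedPerturbation D T) S = boundedPerturbation D (T + S) :=
  LinearPMap.eq_of_eq_graph <| by
    ext ⟨x, y⟩
    simp only [mem_graph_boundedPerturbation_iff, add_apply]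
    rw [sub_sub, add_comm]

/-- `D` is symmetric: its graph is contained in the graph of its adjoint. -/
def IsSymmetricOperator (D : X →ₗ.[ℂ] X) : Prop :=
  ∀ x y, (x, y) ∈ D.graph → ∀ x' y', (x', y') ∈ D.graph → ⟪y, x'⟫[B] = ⟪x, y'⟫[B]

lemma IsSelfAdjointOperator.isSymmetric (hD : IsSelfAdjointOperator D) :
    IsSymmetricOperator D := fun x y hxy x' y' h => by
  have h1 : (x', y') ∈ adjointGraph D := hD.2 ▸ h
  exact mem_adjointGraph_iff.mp h1 x y hxy

lemma IsSymmetricOperator.boundedPerturbation (hD : IsSymmetricOperator D)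
    (hT : ∀ x y : X, ⟪T x, y⟫[B] = ⟪x, T y⟫[B]) :
    IsSymmetricOperator (boundedPerturbation D T) := fun x y hxy x' y' h => by
  have h1 := hD _ _ (mem_graph_boundedPerturbation_iff.mp hxy) _ _
    (mem_graph_boundedPerturbation_iff.mp h)
  rwa [map_sub, map_sub, LinearMap.sub_apply, hT, sub_left_inj] at h1

/-- `‖x‖ ≤ ‖(i + D) x‖` for symmetric `D`. -/
lemma IsSymmetricOperator.norm_le (hD : IsSymmetricOperator D) {x y : X}
    (h : (x, y) ∈ D.graph) : ‖x‖ ≤ ‖Complex.I • x + y‖ := by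
  refine (sq_le_sq₀ (norm_nonneg _) (norm_nonneg _)).mp ?_
  rw [HilbertModule.norm_sq (B := B), HilbertModule.norm_sq (B := B)]
  -- By symmetry the cross terms are `-i⟪x, y⟫` and `i⟪x, y⟫`, which cancel.
  have e : ⟪Complex.I • x + y, Complex.I • x + y⟫[B] = ⟪x, x⟫[B] + ⟪y, y⟫[B] := by
    rw [pre_inner_add_left, pre_inner_add_right, pre_inner_add_right, pre_inner_smul_left,
      pre_inner_smul_left, pre_inner_smul_right, pre_inner_smul_right, hD x y h x y h, smul_smul]
    simp
  obtain ⟨c, hc⟩ := inner_self_pos (B := B) x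
  obtain ⟨d, hd⟩ := inner_self_pos (B := B) y
  rw [e, hc, hd]
  exact norm_le_norm_star_mul_self_add c d

lemma IsResolvent.norm_le_one (hD : IsSymmetricOperator D) (hR : IsResolvent D R) : ‖R‖ ≤ 1 := by
  refine R.opNorm_le_bound zero_le_one fun x => ?_
  simpa using hD.norm_le ((isResolvent_iff.mp hR).1 x)

/-- A right inverse is enough, since the lower bound `IsSymmetricOperator.norm_le` makes `i + D`
injective. -/
lemma IsResolvent.of_isSymmetric (hD : IsSymmetricOperator D)
    (hR : ∀ x, (R x, x - Complex.I • R x) ∈ D.graph) : IsResolvent D R := by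
  refine isResolvent_iff.mpr ⟨hR, fun x y hxy => ?_⟩
  have h1 := hD.norm_le (D.graph.sub_mem (hR (Complex.I • x + y)) hxy)
  have h2 : Complex.I • (R (Complex.I • x + y) - x)
      + (Complex.I • x + y - Complex.I • R (Complex.I • x + y) - y) = 0 := by
    rw [smul_sub]; abel
  have h3 := h1.trans_eq ((congrArg norm h2).trans norm_zero)
  exact sub_eq_zero.mp (norm_le_zero_iff.mp h3)

/-- From `i + D + T = (1 + TR)(i + D)` and `‖TR‖ ≤ ‖T‖ < 1`, the resolvent is `R (1 + TR)⁻¹`. -/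
lemma IsResolvent.exists_of_norm_lt_one (hD : IsSymmetricOperator D) (hR : IsResolvent D R)
    (hT : ∀ x y : X, ⟪T x, y⟫[B] = ⟪x, T y⟫[B]) (hT1 : ‖T‖ < 1) :
    ∃ S, IsResolvent (boundedPerturbation D T) S := by
  have h1 : ‖-(T * R)‖ < 1 := by
    rw [norm_neg]
    refine (norm_mul_le T R).trans_lt ?_
    exact (mul_le_of_le_one_right (norm_nonneg _) (hR.norm_le_one hD)).trans_lt hT1
  -- `V` is `1 + TR`; its inverse is the Neumann series.
  set V := Units.oneSub (-(T * R)) h1 with hV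
  refine ⟨R * ((V⁻¹ : (X →L[ℂ] X)ˣ) : X →L[ℂ] X),
    .of_isSymmetric (hD.boundedPerturbation hT) fun x => ?_⟩
  rw [mem_graph_boundedPerturbation_iff]
  set y := ((V⁻¹ : (X →L[ℂ] X)ˣ) : X →L[ℂ] X) x with hy
  have h2 : y + T (R y) = x := by
    have h3 : (V : X →L[ℂ] X) y = x := by
      rw [hy, ← mul_apply_eq_comp, V.mul_inv, one_apply_eq_self]
    rw [← h3, hV, Units.val_oneSub]
    simp
  have h4 := (isResolvent_iff.mp hR).1 y
  have h5 : x - Complex.I • R y - T (R y) = y - Complex.I • R y := by rw [← h2]; abel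
  change (R y, x - Complex.I • R y - T (R y)) ∈ _
  rwa [h5]

lemma IsResolvent.exists_boundedPerturbation (hD : IsSymmetricOperator D) (hR : IsResolvent D R)
    (hT : ∀ x y : X, ⟪T x, y⟫[B] = ⟪x, T y⟫[B]) :
    ∃ S, IsResolvent (boundedPerturbation D T) S := by
  obtain ⟨n, hn⟩ := exists_nat_gt ‖T‖
  have hn0 : (0 : ℝ) < n := (norm_nonneg _).trans_lt hn
  have hreal : ∀ (r : ℝ) (x y : X), ⟪(r • T) x, y⟫[B] = ⟪x, (r • T) y⟫[B] := by
    intro r x y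
    rw [← Complex.coe_smul, smul_apply, smul_apply, pre_inner_smul_left, pre_inner_smul_right, hT]
    simp
  -- Each step adds `T / n`, of norm below 1. The same step size works throughout because every `D +
  -- (k/n) T` is symmetric and so has a contractive resolvent.
  have key : ∀ k : ℕ, ∃ S, IsResolvent (boundedPerturbation D (((k : ℝ) / n) • T)) S := by
    intro k
    induction k with
    | zero => exact ⟨R, by simpa [boundedPerturbation_zero] using hR⟩
    | succ k ih =>
      obtain ⟨S, hS⟩ := ih
      have h1 := hS.exists_of_norm_lt_one (T := (1 / n : ℝ) • T)
        (hD.boundedPerturbation (hreal _)) (hreal _) (by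
          rw [norm_smul, Real.norm_of_nonneg (by positivity), one_div, inv_mul_lt_iff₀ hn0]
          simpa using hn)
      rw [boundedPerturbation_boundedPerturbation, ← add_smul, ← add_div] at h1
      exact_mod_cast h1
  have h2 := key n
  rwa [div_self hn0.ne', one_smul] at h2

/-- Conjugating by the grading turns `i + D` into `i - D`, so `-γRγ` is a right inverse of `D - i`.
-/
lemma IsResolvent.conj_mem_graph (hD : IsOddOperator D) (hR : IsResolvent D R) (x : X) :
    (-X.grading (R (X.grading x)), x + Complex.I • -X.grading (R (X.grading x))) ∈ D.graph := by
  have h1 := D.graph.neg_mem <|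
    isOddOperator_iff.mp hD _ _ ((isResolvent_iff.mp hR).1 (X.grading x))
  convert h1 using 1
  simp [X.grading_grading, sub_eq_add_neg]

/-- The adjoint of `(D + i)⁻¹` is `(D - i)⁻¹ = -γRγ`; in particular the resolvent is adjointable. -/
lemma IsResolvent.inner_apply (hD : IsSymmetricOperator D) (hD' : IsOddOperator D)
    (hR : IsResolvent D R) (x y : X) :
    ⟪R x, y⟫[B] = ⟪x, -X.grading (R (X.grading y))⟫[B] := by
  have h1 := (isResolvent_iff.mp hR).1 x
  have h2 := hR.conj_mem_graph hD' y
  have h3 := hD _ _ h1 _ _ h2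
  rw [map_sub, LinearMap.sub_apply, pre_inner_add_right, pre_inner_smul_left,
    pre_inner_smul_right, sub_eq_iff_eq_add] at h3
  rw [h3]
  simp

lemma isClosed_adjointGraph (D : X →ₗ.[ℂ] X) : _root_.IsClosed (adjointGraph D) := by
  simp only [adjointGraph, Set.ofPred_forall]
  refine isClosed_iInter fun x => ?_
  exact isClosed_eq ((innerL B X (D x)).continuous.comp continuous_fst)
    ((innerL B X (x : X)).continuous.comp continuous_snd)

/-- For `(y, z)` in the adjoint graph, put `u = (D - i)⁻¹(z - i y)`, which lies in the domain.
Testing against `x = (i + D) R x` gives `⟪x, y⟫ = ⟪R x, z - i y⟫ = ⟪x, u⟫` for every `x`, so `y = u`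
and `z = D y`. -/
theorem IsResolvent.isSelfAdjointOperator (hD : IsSymmetricOperator D) (hD' : IsOddOperator D)
    (hR : IsResolvent D R) (hdense : Dense (D.domain : Set X)) : IsSelfAdjointOperator D := by
  refine ⟨hdense, Set.Subset.antisymm ?_ ?_⟩
  · rintro ⟨y, z⟩ h
    have h1 := hR.conj_mem_graph hD' (z - Complex.I • y)
    set u := -X.grading (R (X.grading (z - Complex.I • y)))
    have h2 : y = u := by
      refine ext_inner B fun x => ?_
      have h3 := (isResolvent_iff.mp hR).1 x
      have h4 := mem_adjointGraph_iff.mp h _ _ h3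
      have h5 := hD _ _ h3 _ _ h1
      simp only [map_sub, LinearMap.sub_apply, pre_inner_add_right, pre_inner_smul_left,
        pre_inner_smul_right, sub_eq_iff_eq_add] at h4 h5
      rw [h4, h5]
      simp [sub_eq_add_neg]
    rw [← h2, sub_add_cancel] at h1
    exact h1
  · rintro ⟨x', y'⟩ h
    exact mem_adjointGraph_iff.mpr fun x y hxy => hD x y hxy x' y' h

/-- Since `1 + D² = (D - i)(D + i)` and both factors are onto, `1 + D⋆D` is even surjective. -/
theorem IsResolvent.isRegularOperator (hD : IsSelfAdjointOperator D) (hD' : IsOddOperator D)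
    (hR : IsResolvent D R) : IsRegularOperator D := by
  refine ⟨?_, hD.1, ?_, ?_⟩
  · change _root_.IsClosed (D.graph : Set (X × X))
    exact hD.2 ▸ isClosed_adjointGraph D
  · convert hD.1
    rw [hD.2]
    exact congrArg (fun p : Submodule ℂ X => (p : Set X)) D.graph_map_fst_eq_domain
  · convert dense_univ
    refine Set.eq_univ_of_forall fun w => ?_
    have h1 := hR.conj_mem_graph hD' w
    set v := -X.grading (R (X.grading w))
    have h2 := (isResolvent_iff.mp hR).1 v
    -- With `v = (D - i)⁻¹ w`, the preimage of `w` is `R v`: here `D R v = v - i R v`, and applying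
    -- `D` again gives `w - R v`.
    have h3 : (v - Complex.I • R v, w + Complex.I • v - Complex.I • (v - Complex.I • R v)) ∈
        adjointGraph D := by
      rw [hD.2]
      exact D.graph.sub_mem h1 (D.graph.smul_mem Complex.I h2)
    refine ⟨R v, _, _, h2, h3, ?_⟩
    simp only [smul_sub, smul_smul, Complex.I_mul_I, neg_smul, one_smul]
    abel

/-! ### Bounded perturbations of unbounded Kasparov modules -/

/-- On generators, `θ_{x,y} S = θ_{x,S⋆y}`; right composition with `S` is linear and continuous, so
this passes to the closed span. -/
lemma comp_mem_compactOperators {K S S' : X →L[ℂ] X} (hK : K ∈ X.compactOperators)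
    (hS : ∀ x y : X, ⟪S x, y⟫[B] = ⟪x, S' y⟫[B]) : K ∘L S ∈ X.compactOperators := by
  have hS' : ∀ x y : X, ⟪S' x, y⟫[B] = ⟪x, S y⟫[B] := fun x y => by
    rw [← star_inner, ← hS, star_inner]
  let Φ : (X →L[ℂ] X) →L[ℂ] (X →L[ℂ] X) := (ContinuousLinearMap.compL ℂ X X X).flip S
  have h1 : X.compactOperators ≤ X.compactOperators.comap (Φ : (X →L[ℂ] X) →ₗ[ℂ] (X →L[ℂ] X)) := by
    refine Submodule.topologicalClosure_minimal _ (Submodule.span_le.mpr ?_)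
      ((Submodule.isClosed_topologicalClosure _).preimage Φ.continuous)
    rintro θ ⟨x, y, hθ⟩
    refine Submodule.le_topologicalClosure _ (Submodule.subset_span ⟨x, S' y, fun z => ?_⟩)
    rw [hS']
    exact hθ _
  exact h1 hK

/-- A bounded adjointable operator is right linear. -/
lemma map_act_of_adjoint {S S' : X →L[ℂ] X} (hS : ∀ x y : X, ⟪S x, y⟫[B] = ⟪x, S' y⟫[B])
    (x : X) (b : B) : S (x ◃ b) = S x ◃ b := by
  have hS' : ∀ x y : X, ⟪S' x, y⟫[B] = ⟪x, S y⟫[B] := fun x y => by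
    rw [← star_inner, ← hS, star_inner]
  refine ext_inner B fun z => ?_
  rw [← hS', inner_act, hS', inner_act]

theorem IsUnboundedKasparovModule.boundedPerturbation {𝒜 : NonUnitalStarSubalgebra ℂ A}
    (hD : X.IsUnboundedKasparovModule 𝒜 D) (hT : ∀ x y : X, ⟪T x, y⟫[B] = ⟪x, T y⟫[B])
    (hT_odd : ∀ x : X, T (X.grading x) = -X.grading (T x)) :
    X.IsUnboundedKasparovModule 𝒜 (boundedPerturbation D T) := by
  obtain ⟨R, hR, hRc⟩ := hD.resolvent
  have hsymm := hD.isSelfAdjoint.isSymmetric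
  have hsymm' := hsymm.boundedPerturbation hT
  have hodd : IsOddOperator (GradedCorrespondence.boundedPerturbation D T) := by
    refine isOddOperator_iff.mpr fun x y h => ?_
    rw [mem_graph_boundedPerturbation_iff] at h ⊢
    have := isOddOperator_iff.mp hD.isOdd _ _ h
    rwa [map_sub, neg_sub', ← hT_odd] at this
  obtain ⟨S, hS⟩ := hR.exists_boundedPerturbation hsymm hT
  have hsa := hS.isSelfAdjointOperator hsymm' hodd hD.isSelfAdjoint.1
  refine ⟨hD.isCountablyGenerated, ?_, hodd, hsa, hS.isRegularOperator hsa hodd,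
    hD.leftAction_mem_domain, fun a ha => ?_, S, hS, fun a ha => ?_⟩
  · refine isRightLinear_iff.mpr fun x y h b => ?_
    rw [mem_graph_boundedPerturbation_iff] at h ⊢
    have := isRightLinear_iff.mp hD.isRightLinear _ _ h b
    rwa [map_sub, LinearMap.sub_apply, ← map_act_of_adjoint hT] at this
  · obtain ⟨d, hd⟩ := hD.commutator a ha
    -- The graded commutator changes by `[T, a] = T a - γ(a) T`, which is bounded.
    refine ⟨d + (T ∘L X.leftAction a - X.leftAction (GradedCStarAlgebra.grading a) ∘L T),
      fun x h => ?_⟩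
    have h1 := hd x h
    change T (X.leftAction a x) + D ⟨X.leftAction a x, h⟩
      - X.leftAction (GradedCStarAlgebra.grading a) (T x + D x) = d x + (T (X.leftAction a x)
      - X.leftAction (GradedCStarAlgebra.grading a) (T x))
    rw [← h1, map_add]
    abel
  -- The second resolvent identity `S = R - R T S`, obtained by applying `R` to `(i + D) S x = x - T
  -- S x`.
  · have h1 : X.leftAction a ∘L S = X.leftAction a ∘L R - (X.leftAction a ∘L R) ∘L (T ∘L S) := by
      ext x
      have h2 := mem_graph_boundedPerturbation_iff.mp ((isResolvent_iff.mp hS).1 x)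
      have h3 := (isResolvent_iff.mp hR).2 _ _ h2
      have h4 : Complex.I • S x + (x - Complex.I • S x - T (S x)) = x - T (S x) := by abel
      rw [h4, map_sub] at h3
      change X.leftAction a (S x) = X.leftAction a (R x) - X.leftAction a (R (T (S x)))
      rw [← map_sub, h3]
    rw [h1]
    -- `T S` has adjoint `S⋆ T` with `S⋆ = -γSγ`, so composing with it on the right preserves
    -- compactness.
    refine Submodule.sub_mem _ (hRc a ha) (comp_mem_compactOperators
      (S' := -(X.grading ∘L S ∘L X.grading) ∘L T) (hRc a ha) fun x y => ?_)
    change ⟪T (S x), y⟫[B] = ⟪x, -X.grading (S (X.grading (T y)))⟫[B]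
    rw [hT, hS.inner_apply hsymm' hodd]

/-! ### The constant family and the path operator on `C([0,1], X)` -/

variable (X) in
/-- Evaluation of a path at `t`. -/
def pathEval (t : I) : X.path →L[ℂ] X := ContinuousMap.evalCLM ℂ t

/-- The pointwise action of a bounded operator on paths. -/
def pathMap (S : X →L[ℂ] X) : X.path →L[ℂ] X.path := S.compLeftContinuous ℂ I

lemma path_ext {ξ η : X.path} (h : ∀ t, X.pathEval t ξ = X.pathEval t η) : ξ = η :=
  ContinuousMap.ext (f := (show C(I, X) from ξ)) (g := η) h

lemma pathEval_act (t : I) (ξ : X.path) (f : C(I, B)) :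
    X.pathEval t (ξ ◃ f) = X.pathEval t ξ ◃ f t := rfl

lemma pathEval_grading (t : I) (ξ : X.path) :
    X.pathEval t (X.path.grading ξ) = X.grading (X.pathEval t ξ) := rfl

lemma pathEval_leftAction (t : I) (a : A) (ξ : X.path) :
    X.pathEval t (X.path.leftAction a ξ) = X.leftAction a (X.pathEval t ξ) := rfl

lemma inner_path_apply (t : I) (ξ η : X.path) :
    ⟪ξ, η⟫[C(I, B)] t = ⟪X.pathEval t ξ, X.pathEval t η⟫[B] := rfl

/-- The continuity condition in the domain is absorbed by `η` being a path: `D ξ(t) = η(t) - t T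
ξ(t)`. Conditions on the path operator thereby become pointwise ones. -/
lemma mem_graph_pathOperator_iff {ξ η : X.path} : (ξ, η) ∈ (pathOperator D T).graph ↔
    ∀ t : I, (X.pathEval t ξ, X.pathEval t η - (t : ℝ) • T (X.pathEval t ξ)) ∈ D.graph := by
  rw [mk_mem_graph_iff]
  constructor
  · rintro ⟨h, rfl⟩ t
    refine mk_mem_graph_iff.mpr ⟨h.choose t, ?_⟩
    exact (add_sub_cancel_right (D ⟨X.pathEval t ξ, h.choose t⟩)
      ((t : ℝ) • T (X.pathEval t ξ))).symm
  · intro h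
    choose h1 h2 using fun t => mk_mem_graph_iff.mp (h t)
    have hc : Continuous fun t : I => D ⟨X.pathEval t ξ, h1 t⟩ := by
      have : Continuous fun t : I => X.pathEval t η - (t : ℝ) • T (X.pathEval t ξ) :=
        (ContinuousMap.continuous (show C(I, X) from η)).sub (continuous_subtype_val.smul
          (T.continuous.comp (ContinuousMap.continuous (show C(I, X) from ξ))))
      exact this.congr fun t => (h2 t).symm
    refine ⟨⟨h1, hc⟩, path_ext fun t => ?_⟩
    exact eq_sub_iff_add_eq.mp (h2 t)

lemma norm_path_le_iff {ξ : X.path} {c : ℝ} (hc : 0 ≤ c) :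
    ‖ξ‖ ≤ c ↔ ∀ t, ‖X.pathEval t ξ‖ ≤ c :=
  ContinuousMap.norm_le (show C(I, X) from ξ) hc

lemma norm_pathEval_le (t : I) (ξ : X.path) : ‖X.pathEval t ξ‖ ≤ ‖ξ‖ :=
  (norm_path_le_iff (norm_nonneg ξ)).mp le_rfl t

/-- The bounded operator `(S ξ)(t) = t • T (ξ t)` on paths. -/
def pathRamp (T : X →L[ℂ] X) : X.path →L[ℂ] X.path :=
  LinearMap.mkContinuous
    { toFun := fun ξ => (⟨fun t => (t : ℝ) • T (X.pathEval t ξ),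
        continuous_subtype_val.smul (T.continuous.comp
          (ContinuousMap.continuous (show C(I, X) from ξ)))⟩ : C(I, X))
      map_add' := fun ξ η => path_ext fun t => by
        change (t : ℝ) • T (X.pathEval t (ξ + η)) =
          (t : ℝ) • T (X.pathEval t ξ) + (t : ℝ) • T (X.pathEval t η)
        rw [map_add, map_add, smul_add]
      map_smul' := fun c ξ => path_ext fun t => by
        change (t : ℝ) • T (X.pathEval t (c • ξ)) = c • (t : ℝ) • T (X.pathEval t ξ)
        rw [map_smul, map_smul, smul_comm] }
    ‖T‖ fun ξ => (norm_path_le_iff (by positivity)).mpr fun t => by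
      change ‖(t : ℝ) • T (X.pathEval t ξ)‖ ≤ _
      rw [norm_smul, Real.norm_of_nonneg t.2.1]
      refine (mul_le_of_le_one_left (norm_nonneg _) t.2.2).trans ?_
      exact (T.le_opNorm _).trans (by gcongr; exact norm_pathEval_le t ξ)

lemma pathEval_pathRamp (t : I) (ξ : X.path) :
    X.pathEval t (pathRamp T ξ) = (t : ℝ) • T (X.pathEval t ξ) := rfl

/-- This reduces the path operator to the constant family, to which the perturbation theorem
applies. -/
lemma pathOperator_eq_boundedPerturbation :
    pathOperator D T = boundedPerturbation (pathOperator D 0) (pathRamp T) :=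
  LinearPMap.eq_of_eq_graph <| by
    ext ⟨ξ, η⟩
    rw [mem_graph_boundedPerturbation_iff, mem_graph_pathOperator_iff, mem_graph_pathOperator_iff]
    simp only [map_sub, pathEval_pathRamp, zero_apply, smul_zero, sub_zero]

lemma mem_graph_pathOperator_zero_iff {ξ η : X.path} : (ξ, η) ∈ (pathOperator D 0).graph ↔
    ∀ t : I, (X.pathEval t ξ, X.pathEval t η) ∈ D.graph := by
  simp only [mem_graph_pathOperator_iff, zero_apply, smul_zero, sub_zero]

lemma inner_pathRamp (hT : ∀ x y : X, ⟪T x, y⟫[B] = ⟪x, T y⟫[B]) (ξ η : X.path) :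
    ⟪pathRamp T ξ, η⟫[C(I, B)] = ⟪ξ, pathRamp T η⟫[C(I, B)] := by
  ext t
  rw [inner_path_apply, inner_path_apply, pathEval_pathRamp, pathEval_pathRamp,
    ← Complex.coe_smul, ← Complex.coe_smul, pre_inner_smul_left, pre_inner_smul_right, hT]
  simp

variable (X) in
/-- The path `t ↦ φ t • x`. -/
def smulConstPath (φ : C(I, ℝ)) (x : X) : X.path := φ • ContinuousMap.const I x

lemma pathEval_smulConstPath (φ : C(I, ℝ)) (x : X) (t : I) :
    X.pathEval t (X.smulConstPath φ x) = φ t • x := rfl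

lemma dense_path_of_smulConstPath_mem {V : Set X} (hV : Dense V) (W : Submodule ℂ X.path)
    (hW : ∀ φ, ∀ x ∈ V, X.smulConstPath φ x ∈ W) : Dense (W : Set X.path) :=
  dense_of_smul_const_mem hV (show Submodule ℂ C(I, X) from W) hW

/-- The constant paths at generators of `X` suffice: the path `φ • (s ◃ b)` is the constant path `s`
acted on by `φ • b` in `C([0,1], B)`. -/
lemma IsCountablyGenerated.path (hX : X.IsCountablyGenerated) :
    X.path.IsCountablyGenerated := by
  obtain ⟨S, hS, hdense⟩ := hX
  refine ⟨X.smulConstPath 1 '' S, hS.image _, dense_path_of_smulConstPath_mem hdense _ ?_⟩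
  intro φ x hx
  induction hx using Submodule.span_induction with
  | mem x hx =>
    obtain ⟨s, hs, b, rfl⟩ := hx
    refine Submodule.subset_span ⟨_, ⟨s, hs, rfl⟩, φ • ContinuousMap.const I b,
      path_ext fun t => ?_⟩
    rw [pathEval_act, pathEval_smulConstPath, pathEval_smulConstPath]
    change φ t • (s ◃ b) = ((1 : ℝ) • s) ◃ (φ t • b)
    rw [one_smul, ← Complex.coe_smul, ← Complex.coe_smul, map_smul]
  | zero =>
    convert Submodule.zero_mem _
    exact path_ext fun t => smul_zero (φ t)
  | add x y _ _ hx hy =>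
    convert Submodule.add_mem _ hx hy
    exact path_ext fun t => smul_add (φ t) x y
  | smul c x _ hx =>
    convert Submodule.smul_mem _ c hx
    exact path_ext fun t => smul_comm (φ t) c x

/-- Applied pointwise, `θ_{x,y}` is the rank-one operator of the constant paths `x` and `y`. Since
`S ↦ pathMap S` is a linear contraction, the closed span follows. -/
lemma pathMap_mem_compactOperators {K : X →L[ℂ] X} (hK : K ∈ X.compactOperators) :
    pathMap K ∈ X.path.compactOperators := by
  let Φ : (X →L[ℂ] X) →L[ℂ] (X.path →L[ℂ] X.path) := LinearMap.mkContinuous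
    { toFun := pathMap, map_add' := fun _ _ => rfl, map_smul' := fun _ _ => rfl } 1 fun S => by
      rw [one_mul]
      refine ContinuousLinearMap.opNorm_le_bound _ (norm_nonneg S) fun ξ => ?_
      refine (norm_path_le_iff (by positivity)).mpr fun t => ?_
      exact (S.le_opNorm _).trans (by gcongr; exact norm_pathEval_le t ξ)
  have h1 : X.compactOperators ≤ X.path.compactOperators.comap
      (Φ : (X →L[ℂ] X) →ₗ[ℂ] (X.path →L[ℂ] X.path)) := by
    refine Submodule.topologicalClosure_minimal _ (Submodule.span_le.mpr ?_)
      ((Submodule.isClosed_topologicalClosure _).preimage Φ.continuous)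
    rintro θ ⟨x, y, hθ⟩
    refine Submodule.le_topologicalClosure _ (Submodule.subset_span
      ⟨X.smulConstPath 1 x, X.smulConstPath 1 y, fun ξ => path_ext fun t => ?_⟩)
    rw [pathEval_act, inner_path_apply, pathEval_smulConstPath, pathEval_smulConstPath,
      ContinuousMap.one_apply, one_smul, one_smul]
    exact hθ _
  exact h1 hK

/-- The resolvent is `R` applied pointwise, so the general resolvent criterion gives selfadjointness
and regularity; the algebraic conditions are checked at each `t`. -/
theorem IsUnboundedKasparovModule.path {𝒜 : NonUnitalStarSubalgebra ℂ A}
    (hD : X.IsUnboundedKasparovModule 𝒜 D) :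
    X.path.IsUnboundedKasparovModule 𝒜 (pathOperator D 0) := by
  obtain ⟨R, hR, hRc⟩ := hD.resolvent
  have hsymm : IsSymmetricOperator (pathOperator D 0) := fun ξ η h ξ' η' h' => by
    rw [mem_graph_pathOperator_zero_iff] at h h'
    ext t
    exact hD.isSelfAdjoint.isSymmetric _ _ (h t) _ _ (h' t)
  have hodd : IsOddOperator (pathOperator D 0) := isOddOperator_iff.mpr fun ξ η h => by
    rw [mem_graph_pathOperator_zero_iff] at h ⊢
    exact fun t => isOddOperator_iff.mp hD.isOdd _ _ (h t)
  have hres : IsResolvent (pathOperator D 0) (pathMap R) := .of_isSymmetric hsymm fun ξ =>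
    mem_graph_pathOperator_zero_iff.mpr fun t => (isResolvent_iff.mp hR).1 _
  have hdense : Dense ((pathOperator D 0).domain : Set X.path) := by
    -- The paths `φ • x` with `x` in the domain of `D` lie in the domain, with image `φ • D x`.
    refine dense_path_of_smulConstPath_mem hD.isSelfAdjoint.1 _ fun φ x hx => ?_
    refine LinearPMap.mem_domain_iff.mpr ⟨X.smulConstPath φ (D ⟨x, hx⟩),
      mem_graph_pathOperator_zero_iff.mpr fun t => ?_⟩
    have := D.graph.smul_mem (φ t : ℂ) (D.mem_graph ⟨x, hx⟩)
    rw [pathEval_smulConstPath, pathEval_smulConstPath, ← Complex.coe_smul, ← Complex.coe_smul]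
    exact this
  have hsa := hres.isSelfAdjointOperator hsymm hodd hdense
  refine ⟨hD.isCountablyGenerated.path, ?_, hodd, hsa, hres.isRegularOperator hsa hodd, ?_, ?_,
    pathMap R, hres, fun a ha => pathMap_mem_compactOperators (hRc a ha)⟩
  · refine isRightLinear_iff.mpr fun ξ η h f => ?_
    rw [mem_graph_pathOperator_zero_iff] at h ⊢
    exact fun t => isRightLinear_iff.mp hD.isRightLinear _ _ (h t) (f t)
  · intro a ha ξ
    obtain ⟨d, hd⟩ := hD.commutator a ha
    -- The bounded commutator gives `D a ξ(t) = d ξ(t) + γ(a) D ξ(t)`, which is continuous in `t`.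
    refine LinearPMap.mem_domain_iff.mpr ⟨pathMap d ξ + X.path.leftAction
      (GradedCStarAlgebra.grading a) (pathOperator D 0 ξ),
      mem_graph_pathOperator_zero_iff.mpr fun t => ?_⟩
    obtain ⟨h1, h2⟩ := mk_mem_graph_iff.mp <| mem_graph_pathOperator_zero_iff.mp
      ((pathOperator D 0).mem_graph ξ) t
    refine mk_mem_graph_iff.mpr ⟨hD.leftAction_mem_domain a ha ⟨_, h1⟩, ?_⟩
    have h3 := hd ⟨_, h1⟩ (hD.leftAction_mem_domain a ha ⟨_, h1⟩)
    rw [h2] at h3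
    exact sub_eq_iff_eq_add.mp h3
  · intro a ha
    obtain ⟨d, hd⟩ := hD.commutator a ha
    refine ⟨pathMap d, fun ξ h => path_ext fun t => ?_⟩
    obtain ⟨h1, h2⟩ := mk_mem_graph_iff.mp <| mem_graph_pathOperator_zero_iff.mp
      ((pathOperator D 0).mem_graph ξ) t
    obtain ⟨h3, h4⟩ := mk_mem_graph_iff.mp <| mem_graph_pathOperator_zero_iff.mp
      ((pathOperator D 0).mem_graph ⟨_, h⟩) t
    have h5 := hd ⟨_, h1⟩ h3
    rw [h2] at h5
    rw [map_sub, ← h4]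
    exact h5

theorem IsUnboundedKasparovModule.pathOperator {𝒜 : NonUnitalStarSubalgebra ℂ A}
    (hD : X.IsUnboundedKasparovModule 𝒜 D) (hT : ∀ x y : X, ⟪T x, y⟫[B] = ⟪x, T y⟫[B])
    (hT_odd : ∀ x : X, T (X.grading x) = -X.grading (T x)) :
    X.path.IsUnboundedKasparovModule 𝒜 (pathOperator D T) := by
  rw [pathOperator_eq_boundedPerturbation]
  refine hD.path.boundedPerturbation (inner_pathRamp hT) fun ξ => path_ext fun t => ?_
  rw [pathEval_pathRamp, pathEval_grading, hT_odd, map_neg, pathEval_grading, pathEval_pathRamp,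
    smul_neg, ← Complex.coe_smul, ← Complex.coe_smul, map_smul]

/-! ### The interior tensor product along evaluation -/

variable (X) in
/-- The isometry `ξ ⊗ b ↦ ξ t ◃ b` on the algebraic tensor product. -/
def evTensorPath (t : I) : EvTensor X.path t →ₗᵢ[ℂ] X where
  toLinearMap := (X.pathEval t : X.path →ₗ[ℂ] X) ∘ₗ evTensorMul X.path t
  norm_map' ξ := by
    rw [evTensor_norm, evTensor_inner, inner_path_apply]
    refine (Real.sqrt_eq_iff_mul_self_eq (norm_nonneg _) (norm_nonneg _)).mpr ?_ |>.symm
    rw [← sq]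
    exact (HilbertModule.norm_sq (B := B) (X.pathEval t (evTensorMul X.path t ξ))).symm

variable (X) in
/-- The isometry `ξ ⊗ b ↦ ξ t ◃ b` on the interior tensor product. -/
def evPath (t : I) : X.path.ev t →L[ℂ] X :=
  (X.evTensorPath t).toContinuousLinearMap.extend UniformSpace.Completion.toComplL

lemma evPath_coe (t : I) (ξ : EvTensor X.path t) :
    X.evPath t (ξ : UniformSpace.Completion (EvTensor X.path t)) =
      X.pathEval t (evTensorMul X.path t ξ) :=
  ContinuousLinearMap.extend_eq (X.evTensorPath t).toContinuousLinearMap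
    UniformSpace.Completion.denseRange_coe
    (UniformSpace.Completion.isUniformInducing_coe (EvTensor X.path t)) ξ

lemma evPath_evMk (t : I) (ξ : X.path) (b : B) :
    X.evPath t (X.path.evMk t ξ b) = X.pathEval t ξ ◃ b := evPath_coe t _

@[elab_as_elim]
lemma ev_induction {Y : GradedCorrespondence.{u, v, w} A C(I, B)} {t : I} {p : Y.ev t → Prop}
    (hp : _root_.IsClosed {x | p x})
    (ih : ∀ ξ : EvTensor Y t, p (ξ : UniformSpace.Completion (EvTensor Y t))) (x : Y.ev t) : p x :=
  UniformSpace.Completion.induction_on x hp ih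

lemma inner_ev_coe {Y : GradedCorrespondence.{u, v, w} A C(I, B)} {t : I}
    (ξ η : EvTensor Y t) :
    (PreHilbertModule.inner (B := B) (X := Y.ev t) (ξ : UniformSpace.Completion (EvTensor Y t))
      (η : UniformSpace.Completion (EvTensor Y t))) =
      ⟪evTensorMul Y t ξ, evTensorMul Y t η⟫[C(I, B)] t :=
  completion_inner_coe ξ η

lemma inner_evPath (t : I) (x y : X.path.ev t) : ⟪X.evPath t x, X.evPath t y⟫[B] = ⟪x, y⟫[B] := by
  change innerL B X (X.evPath t x) (X.evPath t y) = innerL B (X.path.ev t) x y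
  induction x using ev_induction with
  | hp => exact isClosed_eq (by fun_prop) (by fun_prop)
  | ih ξ =>
    induction y using ev_induction with
    | hp => exact isClosed_eq (by fun_prop) (by fun_prop)
    | ih η =>
      rw [innerL_apply, evPath_coe, evPath_coe]
      exact (inner_ev_coe ξ η).symm

lemma norm_evPath (t : I) (x : X.path.ev t) : ‖X.evPath t x‖ = ‖x‖ := by
  refine (sq_eq_sq₀ (norm_nonneg _) (norm_nonneg _)).mp ?_
  rw [HilbertModule.norm_sq (B := B), HilbertModule.norm_sq (B := B), inner_evPath]

lemma evPath_act (t : I) (x : X.path.ev t) (b : B) : X.evPath t (x ◃ b) = X.evPath t x ◃ b := by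
  change X.evPath t (actL B (X.path.ev t) x b) = actL B X (X.evPath t x) b
  induction x using ev_induction with
  | hp => exact isClosed_eq (by fun_prop) (by fun_prop)
  | ih ξ =>
    have h : actL B (X.path.ev t) (ξ : UniformSpace.Completion (EvTensor X.path t)) b =
      ((evTensorAct X.path t ξ b : EvTensor X.path t) : UniformSpace.Completion _) :=
      completion_act_coe ξ b
    rw [h, evPath_coe, evPath_coe, evTensorMul_act, pathEval_act]
    rfl

lemma evPath_grading (t : I) (x : X.path.ev t) :
    X.evPath t ((X.path.ev t).grading x) = X.grading (X.evPath t x) := by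
  induction x using ev_induction with
  | hp => exact isClosed_eq (by fun_prop) (by fun_prop)
  | ih ξ =>
    have h : (X.path.ev t).grading (ξ : UniformSpace.Completion (EvTensor X.path t)) =
      ((evTensorGradingₗ X.path t ξ : EvTensor X.path t) : UniformSpace.Completion _) :=
      complMap_coe _ ξ
    rw [h, evPath_coe, evPath_coe, evTensorMul_grading, pathEval_grading]

lemma evPath_leftAction (t : I) (a : A) (x : X.path.ev t) :
    X.evPath t ((X.path.ev t).leftAction a x) = X.leftAction a (X.evPath t x) := by
  induction x using ev_induction with
  | hp => exact isClosed_eq (by fun_prop) (by fun_prop)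
  | ih ξ =>
    have h : (X.path.ev t).leftAction a (ξ : UniformSpace.Completion (EvTensor X.path t)) =
      ((evTensorLeftₗ X.path t a ξ : EvTensor X.path t) : UniformSpace.Completion _) :=
      complMap_coe _ ξ
    rw [h, evPath_coe, evPath_coe, evTensorMul_left, pathEval_leftAction]

/-- An isometry on a complete space has closed range. The range contains every `x ◃ b`, as the image
of (constant path `x`) `⊗ b`, and these converge to `x` along an approximate unit. -/
lemma evPath_bijective (t : I) : Function.Bijective (X.evPath t) := by
  have hiso : Isometry (X.evPath t) := AddMonoidHomClass.isometry_of_norm _ (norm_evPath t)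
  refine ⟨hiso.injective, fun x => ?_⟩
  obtain ⟨l, hl, h⟩ := exists_tendsto_act B
  have hcl : _root_.IsClosed (Set.range (X.evPath t)) := hiso.isClosedEmbedding.isClosed_range
  refine hcl.mem_of_tendsto (h X x) (Eventually.of_forall fun b => ?_)
  refine ⟨X.path.evMk t (X.smulConstPath 1 x) b, ?_⟩
  rw [evPath_evMk, pathEval_smulConstPath, ContinuousMap.one_apply, one_smul]

variable (X) in
/-- The unitary isomorphism from the interior tensor product of `C([0,1], X)` and `B` along
evaluation at `t` to `X`. -/
def evPathEquiv (t : I) : X.path.ev t ≃L[ℂ] X :=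
  (LinearIsometryEquiv.ofSurjective ⟨(X.evPath t : X.path.ev t →ₗ[ℂ] X), norm_evPath t⟩
    (evPath_bijective t).2).toContinuousLinearEquiv

lemma evPathEquiv_apply (t : I) (x : X.path.ev t) : X.evPathEquiv t x = X.evPath t x := rfl

/-- Under `X.path.ev t ≃ X` the span defining `E ⊗ 1` has closure the graph of `D + t T`. -/
lemma mem_topologicalClosure_span_evMk_iff (hD : IsSelfAdjointOperator D) (hD' : IsRightLinear D)
    (hT : ∀ x y : X, ⟪T x, y⟫[B] = ⟪x, T y⟫[B]) (t : I) (x y : X.path.ev t) :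
    (x, y) ∈ (Submodule.span ℂ {p : X.path.ev t × X.path.ev t |
      ∃ (ξ : (pathOperator D T).domain) (b : B),
        p = (X.path.evMk t ξ b, X.path.evMk t (pathOperator D T ξ) b)}).topologicalClosure ↔
    (X.evPath t x, X.evPath t y) ∈ (boundedPerturbation D ((t : ℝ) • T)).graph := by
  set W := Submodule.span ℂ {p : X.path.ev t × X.path.ev t |
      ∃ (ξ : (pathOperator D T).domain) (b : B),
        p = (X.path.evMk t ξ b, X.path.evMk t (pathOperator D T ξ) b)} with hW
  set U := X.evPathEquiv t with hU
  have hclosed : _root_.IsClosed (D.graph : Set (X × X)) := hD.2 ▸ isClosed_adjointGraph D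
  have hclosed' :
      _root_.IsClosed ((boundedPerturbation D ((t : ℝ) • T)).graph : Set (X × X)) := by
    have : ((boundedPerturbation D ((t : ℝ) • T)).graph : Set (X × X)) =
        (fun p : X × X => (p.1, p.2 - ((t : ℝ) • T) p.1)) ⁻¹' D.graph := by
      ext ⟨x, y⟩
      exact mem_graph_boundedPerturbation_iff
    rw [this]
    exact hclosed.preimage (by fun_prop)
  constructor
  · intro h
    let Φ : X.path.ev t × X.path.ev t →L[ℂ] X × X := (X.evPath t).prodMap (X.evPath t)
    -- The graph of `D + tT` is closed, so only the generators matter; they are mapped to `(ξ(t) b,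
    -- (D + tT) ξ(t) b)`, which lies in the graph by right linearity.
    have h1 : W.topologicalClosure ≤ (boundedPerturbation D ((t : ℝ) • T)).graph.comap
        (Φ : X.path.ev t × X.path.ev t →ₗ[ℂ] X × X) := by
      refine Submodule.topologicalClosure_minimal _ (Submodule.span_le.mpr ?_)
        (hclosed'.preimage Φ.continuous)
      rintro _ ⟨ξ, b, rfl⟩
      change (X.evPath t (X.path.evMk t ξ b), X.evPath t (X.path.evMk t (pathOperator D T ξ) b)) ∈
        (boundedPerturbation D ((t : ℝ) • T)).graph
      rw [evPath_evMk, evPath_evMk, mem_graph_boundedPerturbation_iff]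
      have h2 := mem_graph_pathOperator_iff.mp ((pathOperator D T).mem_graph ξ) t
      have h3 := isRightLinear_iff.mp hD' _ _ h2 b
      rwa [map_sub, LinearMap.sub_apply, ← Complex.coe_smul, map_smul, LinearMap.smul_apply,
        ← map_act_of_adjoint hT, Complex.coe_smul] at h3
    exact h1 h
  · intro h
    rw [mem_graph_boundedPerturbation_iff] at h
    set x' := X.evPath t x with hx'
    set z := X.evPath t y - ((t : ℝ) • T) x' with hz
    obtain ⟨l, hl, hact⟩ := exists_tendsto_act B
    -- Cutting both entries down by the same approximate unit writes `(x, y)` as a limit of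
    -- generators.
    have hlim : Tendsto (fun b : B => (U.symm (x' ◃ b), U.symm (X.evPath t y ◃ b))) l
        (𝓝 (x, y)) := by
      have e1 : U.symm x' = x := U.symm_apply_apply x
      have e2 : U.symm (X.evPath t y) = y := U.symm_apply_apply y
      have h1 := (U.symm.continuous.tendsto x').comp (hact X x')
      have h2 := (U.symm.continuous.tendsto (X.evPath t y)).comp (hact X (X.evPath t y))
      rw [e1] at h1
      rw [e2] at h2
      exact h1.prodMk_nhds h2
    refine W.isClosed_topologicalClosure.mem_of_tendsto hlim (Eventually.of_forall fun b => ?_)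
    refine W.le_topologicalClosure (Submodule.subset_span ?_)
    -- Here `z = D x'`, so the constant path at `x'` has image `s ↦ z + s T x'`, whose value at `s =
    -- t` is `X.evPath t y`.
    have h3 : (X.smulConstPath 1 x', X.smulConstPath 1 z + pathRamp T (X.smulConstPath 1 x')) ∈
        (pathOperator D T).graph := mem_graph_pathOperator_iff.mpr fun s => by
      simpa [pathEval_smulConstPath, pathEval_pathRamp] using h
    obtain ⟨h4, h5⟩ := mk_mem_graph_iff.mp h3
    refine ⟨⟨_, h4⟩, b, ?_⟩
    rw [h5, Prod.mk.injEq, U.symm_apply_eq, U.symm_apply_eq, hU, evPathEquiv_apply,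
      evPathEquiv_apply, evPath_evMk, evPath_evMk]
    simp [pathEval_smulConstPath, pathEval_pathRamp, hz]

theorem unitarilyEquivalent_evOperator_pathOperator (hD : IsSelfAdjointOperator D)
    (hD' : IsRightLinear D) (hT : ∀ x y : X, ⟪T x, y⟫[B] = ⟪x, T y⟫[B]) (t : I) :
    UnitarilyEquivalent (X.path.evOperator t (pathOperator D T))
      (boundedPerturbation D ((t : ℝ) • T)) := by
  refine ⟨(X.evPathEquiv t).toLinearEquiv, evPath_act t, inner_evPath t, evPath_grading t,
    evPath_leftAction t, fun x y => ?_⟩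
  rw [evOperator, Submodule.toLinearPMap_graph_eq]
  · exact mem_topologicalClosure_span_evMk_iff hD hD' hT t x y
  -- `toLinearPMap` has the given subspace as its graph only if that subspace is single-valued, that
  -- is, if the span is closable. This is inherited from the graph of `D + tT` by injectivity of
  -- `evPath`.
  · rintro ⟨x, y⟩ h rfl
    have h1 := (mem_topologicalClosure_span_evMk_iff hD hD' hT t _ _).mp h
    rw [map_zero] at h1
    have h2 := LinearPMap.graph_fst_eq_zero_snd _ h1 rfl
    exact (evPath_bijective t).1 (h2.trans (map_zero _).symm)

end GradedCorrespondence

end UnboundedKK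

end

/-! ### The main theorem -/

theorem mainTheorem9 {A : Type u} {B : Type v} [NonUnitalCStarAlgebra A] [NonUnitalCStarAlgebra B]
    [GradedCStarAlgebra A] [GradedCStarAlgebra B] [TopologicalSpace.SeparableSpace A]
    (hB : IsSigmaUnital B) (𝒜 : NonUnitalStarSubalgebra ℂ A)
    (h𝒜_graded : ∀ a ∈ 𝒜, GradedCStarAlgebra.grading a ∈ 𝒜)
    (h𝒜_dense : Dense (𝒜 : Set A))
    (h𝒜_countable : ∃ S : Set A, S.Countable ∧ NonUnitalStarAlgebra.adjoin ℂ S = 𝒜)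
    (X : GradedCorrespondence.{u, v, w} A B) (D : X →ₗ.[ℂ] X)
    (hD : X.IsUnboundedKasparovModule 𝒜 D) (T : X →L[ℂ] X)
    (hT_selfAdjoint : ∀ x y : X, ⟪T x, y⟫[B] = ⟪x, T y⟫[B])
    (hT_odd : ∀ x : X, T (X.grading x) = -X.grading (T x)) :
    X.IsUnboundedKasparovModule 𝒜 (boundedPerturbation D T) ∧
      Homotopic 𝒜 D (boundedPerturbation D T) ∧
      IsHomotopy 𝒜 (pathOperator D T) D (boundedPerturbation D T) := by
  have h : IsHomotopy 𝒜 (pathOperator D T) D (boundedPerturbation D T) := by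
    refine ⟨hD.pathOperator hT_selfAdjoint hT_odd, ?_, ?_⟩
    · simpa [boundedPerturbation_zero] using unitarilyEquivalent_evOperator_pathOperator
        hD.isSelfAdjoint hD.isRightLinear hT_selfAdjoint 0
    · simpa using unitarilyEquivalent_evOperator_pathOperator
        hD.isSelfAdjoint hD.isRightLinear hT_selfAdjoint 1
  exact ⟨hD.boundedPerturbation hT_selfAdjoint hT_odd, ⟨X.path, pathOperator D T, h⟩, h⟩
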